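/- Let $(\mathcal L,\le)$ be a semilattice, i.e. an ordered set in which any two elements $i,j$ have a greatest lower bound $i\wedge j$. Let $\mathfrak A$ be a (complex, not necessarily unital) $C^*$-algebra graded by $\mathcal L$, that is, equipped with a family $(A_i)_{i\in\mathcal L}$ of $C^*$-subalgebras (norm-closed $*$-subalgebras) of $\mathfrak A$, called its components, which is linearly independent, whose union spans a dense subspace of $\mathfrak A$, and which satisfies $A_iA_j\subset A_{i\wedge j}$ for all $i,j\in\mathcal L$. Then $\mathfrak A$ is exact if and only if $A_i$ is exact for every $i\in\mathcal L$. Here a $C^*$-algebra $D$ is called exact if for every short exact sequence of $C^*$-algebras $0\to A\xrightarrow{\iota}B\xrightarrow{p}C\to 0$ the sequence $$0\to A\otimes_{\min}D\xrightarrow{\iota\otimes_{\min}\mathrm{Id}_D}B\otimes_{\min}D\xrightarrow{p\otimes_{\min}\mathrm{Id}_D}C\otimes_{\min}D\to 0$$ is exact, where $\otimes_{\min}$ denotes the minimal (spatial) tensor product of $C^*$-algebras. -/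

import Mathlib

open scoped TensorProduct
open UniformSpace

universe u v w

noncomputable section

/-! ### Tensor products of Hilbert space operators and of representations -/

namespace CStarTensor

section Operators

variable (H K : Type*) [NormedAddCommGroup H] [InnerProductSpace ℂ H]
  [NormedAddCommGroup K] [InnerProductSpace ℂ K]

/-- The Hilbert tensor product of `H` and `K`: the completion of the algebraic tensor product for
the inner product with `⟪h₁ ⊗ k₁, h₂ ⊗ k₂⟫ = ⟪h₁, h₂⟫ ⟪k₁, k₂⟫`. -/
def HilbertTensor : Type _ := Completion (H ⊗[ℂ] K)

instance : NormedAddCommGroup (HilbertTensor H K) :=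
  inferInstanceAs (NormedAddCommGroup (Completion (H ⊗[ℂ] K)))

instance : InnerProductSpace ℂ (HilbertTensor H K) :=
  inferInstanceAs (InnerProductSpace ℂ (Completion (H ⊗[ℂ] K)))

instance : CompleteSpace (HilbertTensor H K) :=
  inferInstanceAs (CompleteSpace (Completion (H ⊗[ℂ] K)))

/-- The isometric embedding of the algebraic into the Hilbert tensor product. -/
def HilbertTensor.of : H ⊗[ℂ] K →ₗᵢ[ℂ] HilbertTensor H K := Completion.toComplₗᵢ

variable {H K}

theorem HilbertTensor.induction_on {p : HilbertTensor H K → Prop} (x : HilbertTensor H K)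
    (hp : IsClosed {x | p x}) (ih : ∀ y : H ⊗[ℂ] K, p (HilbertTensor.of H K y)) : p x :=
  Completion.induction_on x hp ih

/-- The bounded operator `S ⊗ T` on the Hilbert tensor product, with
`(S ⊗ T) (h ⊗ k) = S h ⊗ T k`. -/
def opTensor (S : H →L[ℂ] H) (T : K →L[ℂ] K) :
    HilbertTensor H K →L[ℂ] HilbertTensor H K :=
  (TensorProduct.mapL S T).completion

theorem HilbertTensor.ext_of {F : Type*} [NormedAddCommGroup F] [NormedSpace ℂ F]
    {f g : HilbertTensor H K →L[ℂ] F}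
    (h : ∀ x : H ⊗[ℂ] K, f (HilbertTensor.of H K x) = g (HilbertTensor.of H K x)) : f = g := by
  ext x
  induction x using HilbertTensor.induction_on with
  | hp => exact isClosed_eq f.continuous g.continuous
  | ih x => exact h x

theorem opTensor_of (S : H →L[ℂ] H) (T : K →L[ℂ] K) (x : H ⊗[ℂ] K) :
    opTensor S T (HilbertTensor.of H K x) =
      HilbertTensor.of H K (TensorProduct.mapL S T x) :=
  ContinuousLinearMap.completion_apply_coe (TensorProduct.mapL S T) x

theorem opTensor_of_tmul (S : H →L[ℂ] H) (T : K →L[ℂ] K) (h : H) (k : K) :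
    opTensor S T (HilbertTensor.of H K (h ⊗ₜ[ℂ] k)) =
      HilbertTensor.of H K (S h ⊗ₜ[ℂ] T k) := by
  rw [opTensor_of]; simp

theorem opTensor_add_left (S S' : H →L[ℂ] H) (T : K →L[ℂ] K) :
    opTensor (S + S') T = opTensor S T + opTensor S' T :=
  HilbertTensor.ext_of fun x => by
    simp only [opTensor_of, TensorProduct.mapL_add_left, add_apply, map_add]

theorem opTensor_add_right (S : H →L[ℂ] H) (T T' : K →L[ℂ] K) :
    opTensor S (T + T') = opTensor S T + opTensor S T' :=
  HilbertTensor.ext_of fun x => by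
    simp only [opTensor_of, TensorProduct.mapL_add_right, add_apply, map_add]

theorem opTensor_smul_left (c : ℂ) (S : H →L[ℂ] H) (T : K →L[ℂ] K) :
    opTensor (c • S) T = c • opTensor S T :=
  HilbertTensor.ext_of fun x => by
    simp only [opTensor_of, TensorProduct.mapL_smul_left, map_smul,
      smul_apply]

theorem opTensor_smul_right (c : ℂ) (S : H →L[ℂ] H) (T : K →L[ℂ] K) :
    opTensor S (c • T) = c • opTensor S T :=
  HilbertTensor.ext_of fun x => by
    simp only [opTensor_of, TensorProduct.mapL_smul_right, map_smul,
      smul_apply]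

theorem opTensor_mul (S S' : H →L[ℂ] H) (T T' : K →L[ℂ] K) :
    opTensor (S * S') (T * T') = opTensor S T * opTensor S' T' :=
  HilbertTensor.ext_of fun x => by
    change _ = opTensor S T (opTensor S' T' (HilbertTensor.of H K x))
    rw [opTensor_of, TensorProduct.mapL_mul, opTensor_of, opTensor_of]
    rfl

theorem inner_mapL_left [CompleteSpace H] [CompleteSpace K] (S : H →L[ℂ] H) (T : K →L[ℂ] K)
    (x y : H ⊗[ℂ] K) :
    inner ℂ (TensorProduct.mapL (star S) (star T) x) y =
      inner ℂ x (TensorProduct.mapL S T y) := by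
  induction x with
  | zero => simp
  | add a b ha hb => simp only [map_add, inner_add_left, ha, hb]
  | tmul a b =>
    induction y with
    | zero => simp
    | add c d hc hd => simp only [map_add, inner_add_right, hc, hd]
    | tmul c d =>
      simp [ContinuousLinearMap.star_eq_adjoint, ContinuousLinearMap.adjoint_inner_left]

theorem opTensor_star [CompleteSpace H] [CompleteSpace K] (S : H →L[ℂ] H) (T : K →L[ℂ] K) :
    opTensor (star S) (star T) = star (opTensor S T) := by
  rw [ContinuousLinearMap.star_eq_adjoint (opTensor S T), ContinuousLinearMap.eq_adjoint_iff]
  intro x y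
  induction x using HilbertTensor.induction_on with
  | hp => exact isClosed_eq (by fun_prop) (by fun_prop)
  | ih x =>
    induction y using HilbertTensor.induction_on with
    | hp => exact isClosed_eq (by fun_prop) (by fun_prop)
    | ih y =>
      rw [opTensor_of, opTensor_of, LinearIsometry.inner_map_map, LinearIsometry.inner_map_map,
        inner_mapL_left]

theorem opTensor_norm_le (S : H →L[ℂ] H) (T : K →L[ℂ] K) : ‖opTensor S T‖ ≤ ‖S‖ * ‖T‖ := by
  refine ContinuousLinearMap.opNorm_le_bound _ (by positivity) fun x => ?_
  induction x using HilbertTensor.induction_on with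
  | hp => exact isClosed_le (by fun_prop) (by fun_prop)
  | ih x =>
    rw [opTensor_of, LinearIsometry.norm_map, LinearIsometry.norm_map]
    refine (ContinuousLinearMap.le_opNorm _ x).trans ?_
    gcongr
    exact TensorProduct.norm_mapL_le S T

/-- The operator `S ⊗ T` as a bilinear expression in `S` and `T`. -/
def opTensorBilin : (H →L[ℂ] H) →ₗ[ℂ] (K →L[ℂ] K) →ₗ[ℂ]
    (HilbertTensor H K →L[ℂ] HilbertTensor H K) :=
  LinearMap.mk₂ ℂ opTensor opTensor_add_left opTensor_smul_left opTensor_add_right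
    opTensor_smul_right

end Operators

/-- A representation of the C⋆-algebra `A` on a Hilbert space. -/
structure HilbertRep (A : Type u) [NonUnitalCStarAlgebra A] where
  /-- the Hilbert space -/
  space : Type u
  [normed : NormedAddCommGroup space]
  [inner : InnerProductSpace ℂ space]
  [complete : CompleteSpace space]
  /-- the ⋆-homomorphism to the bounded operators -/
  hom : A →⋆ₙₐ[ℂ] (space →L[ℂ] space)

attribute [instance] HilbertRep.normed HilbertRep.inner HilbertRep.complete

namespace HilbertRep

/-- The representation of `A` on the zero space. -/
instance (A : Type u) [NonUnitalCStarAlgebra A] : Inhabited (HilbertRep A) :=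
  ⟨{ space := PUnit, hom := 0 }⟩

/-- The pullback of a representation along a ⋆-homomorphism. -/
def comap {A B : Type u} [NonUnitalCStarAlgebra A] [NonUnitalCStarAlgebra B]
    (π : HilbertRep B) (f : A →⋆ₙₐ[ℂ] B) : HilbertRep A where
  space := π.space
  hom := π.hom.comp f

end HilbertRep

section Representations

variable {A : Type u} {B : Type v} [NonUnitalCStarAlgebra A] [NonUnitalCStarAlgebra B]

/-- The map `π ⊙ ρ : A ⊙ B → 𝔹(H ⊗ K)` with `(π ⊙ ρ) (a ⊗ b) = π a ⊗ ρ b`. -/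
def repTensor (π : HilbertRep A) (ρ : HilbertRep B) :
    A ⊗[ℂ] B →ₗ[ℂ]
      (HilbertTensor π.space ρ.space →L[ℂ] HilbertTensor π.space ρ.space) :=
  TensorProduct.lift
    (opTensorBilin.compl₁₂ (π.hom : A →ₗ[ℂ] (π.space →L[ℂ] π.space))
      (ρ.hom : B →ₗ[ℂ] (ρ.space →L[ℂ] ρ.space)))

@[simp]
theorem repTensor_tmul (π : HilbertRep A) (ρ : HilbertRep B) (a : A) (b : B) :
    repTensor π ρ (a ⊗ₜ[ℂ] b) = opTensor (π.hom a) (ρ.hom b) := rfl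

theorem repTensor_mul (π : HilbertRep A) (ρ : HilbertRep B) (x y : A ⊗[ℂ] B) :
    repTensor π ρ (x * y) = repTensor π ρ x * repTensor π ρ y := by
  induction x with
  | zero => simp
  | add a b ha hb => simp only [add_mul, map_add, ha, hb]
  | tmul a b =>
    induction y with
    | zero => simp
    | add c d hc hd => simp only [mul_add, map_add, hc, hd]
    | tmul c d =>
      rw [Algebra.TensorProduct.tmul_mul_tmul, repTensor_tmul, repTensor_tmul, repTensor_tmul,
        map_mul, map_mul, opTensor_mul]

theorem repTensor_star (π : HilbertRep A) (ρ : HilbertRep B) (x : A ⊗[ℂ] B) :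
    repTensor π ρ (star x) = star (repTensor π ρ x) := by
  induction x with
  | zero => simp
  | add a b ha hb => simp only [star_add, map_add, ha, hb]
  | tmul a b =>
    rw [TensorProduct.star_tmul, repTensor_tmul, repTensor_tmul, map_star, map_star,
      opTensor_star]

/-- The spatial norm of `t ∈ A ⊙ B`: the supremum of `‖(π ⊙ ρ) t‖` over all
representations `π` of `A` and `ρ` of `B` on Hilbert spaces. The supremum is attained at every
pair of faithful representations. -/
def minNorm (t : A ⊗[ℂ] B) : ℝ :=
  ⨆ p : HilbertRep A × HilbertRep B, ‖repTensor p.1 p.2 t‖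


theorem exists_bound (t : A ⊗[ℂ] B) :
    ∃ C : ℝ, ∀ p : HilbertRep A × HilbertRep B, ‖repTensor p.1 p.2 t‖ ≤ C := by
  induction t with
  | zero => exact ⟨0, fun p => by simp⟩
  | add x y hx hy =>
    obtain ⟨C, hC⟩ := hx
    obtain ⟨D, hD⟩ := hy
    refine ⟨C + D, fun p => ?_⟩
    rw [map_add]
    exact (norm_add_le _ _).trans (add_le_add (hC p) (hD p))
  | tmul a b =>
    refine ⟨‖a‖ * ‖b‖, fun p => ?_⟩
    rw [repTensor_tmul]
    refine (opTensor_norm_le _ _).trans ?_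
    gcongr
    · exact NonUnitalStarAlgHom.norm_apply_le p.1.hom a
    · exact NonUnitalStarAlgHom.norm_apply_le p.2.hom b

theorem bddAbove_rep (t : A ⊗[ℂ] B) :
    BddAbove (Set.range fun p : HilbertRep A × HilbertRep B => ‖repTensor p.1 p.2 t‖) := by
  obtain ⟨C, hC⟩ := exists_bound t
  exact ⟨C, by rintro _ ⟨p, rfl⟩; exact hC p⟩

theorem le_minNorm (π : HilbertRep A) (ρ : HilbertRep B) (t : A ⊗[ℂ] B) :
    ‖repTensor π ρ t‖ ≤ minNorm t :=
  le_ciSup (bddAbove_rep t) (π, ρ)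

theorem minNorm_le {t : A ⊗[ℂ] B} {C : ℝ}
    (h : ∀ (π : HilbertRep A) (ρ : HilbertRep B), ‖repTensor π ρ t‖ ≤ C) : minNorm t ≤ C :=
  ciSup_le fun p => h p.1 p.2

theorem minNorm_nonneg (t : A ⊗[ℂ] B) : 0 ≤ minNorm t :=
  Real.iSup_nonneg fun _ => norm_nonneg _

theorem minNorm_add_le (s t : A ⊗[ℂ] B) : minNorm (s + t) ≤ minNorm s + minNorm t :=
  minNorm_le fun π ρ => by
    rw [map_add]
    exact (norm_add_le _ _).trans (add_le_add (le_minNorm π ρ s) (le_minNorm π ρ t))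

theorem minNorm_smul_le (c : ℂ) (t : A ⊗[ℂ] B) : minNorm (c • t) ≤ ‖c‖ * minNorm t :=
  minNorm_le fun π ρ => by
    rw [map_smul, norm_smul]
    gcongr
    exact le_minNorm π ρ t

theorem minNorm_zero : minNorm (0 : A ⊗[ℂ] B) = 0 :=
  le_antisymm (minNorm_le fun π ρ => by simp) (minNorm_nonneg _)

theorem minNorm_neg (t : A ⊗[ℂ] B) : minNorm (-t) = minNorm t := by
  simp [minNorm]

theorem minNorm_mul_le (s t : A ⊗[ℂ] B) : minNorm (s * t) ≤ minNorm s * minNorm t :=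
  minNorm_le fun π ρ => by
    rw [repTensor_mul]
    exact (norm_mul_le _ _).trans
      (mul_le_mul (le_minNorm π ρ s) (le_minNorm π ρ t) (norm_nonneg _) (minNorm_nonneg _))

theorem minNorm_star_le (t : A ⊗[ℂ] B) : minNorm (star t) ≤ minNorm t :=
  minNorm_le fun π ρ => by
    rw [repTensor_star]
    exact (norm_star _).trans_le (le_minNorm π ρ t)

theorem minNorm_sq_le (t : A ⊗[ℂ] B) : minNorm t * minNorm t ≤ minNorm (star t * t) := by
  have h : minNorm t ≤ √(minNorm (star t * t)) := minNorm_le fun π ρ => by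
    refine Real.le_sqrt_of_sq_le ?_
    have h2 := le_minNorm π ρ (star t * t)
    rw [repTensor_mul, repTensor_star] at h2
    rw [sq]
    exact (CStarRing.norm_star_mul_self (x := repTensor π ρ t)).symm.trans_le h2
  exact (mul_self_le_mul_self (minNorm_nonneg t) h).trans_eq
    (Real.mul_self_sqrt (minNorm_nonneg _))

theorem star_mul_tensor (x y : A ⊗[ℂ] B) : star (x * y) = star y * star x := by
  induction x with
  | zero => simp
  | add a b ha hb => simp only [add_mul, mul_add, star_add, ha, hb]
  | tmul a b =>
    induction y with
    | zero => simp
    | add c d hc hd => simp only [add_mul, mul_add, star_add, hc, hd]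
    | tmul c d => simp

end Representations

/-! ### The minimal tensor product -/

/-- The algebraic tensor product `A ⊙ B`, to be equipped with the spatial norm. -/
def AlgTensor (A : Type u) (B : Type v) [NonUnitalCStarAlgebra A] [NonUnitalCStarAlgebra B] :
    Type (max u v) :=
  A ⊗[ℂ] B

namespace AlgTensor

variable {A : Type u} {B : Type v} [NonUnitalCStarAlgebra A] [NonUnitalCStarAlgebra B]

instance : NonUnitalRing (AlgTensor A B) := inferInstanceAs (NonUnitalRing (A ⊗[ℂ] B))
instance : Module ℂ (AlgTensor A B) := inferInstanceAs (Module ℂ (A ⊗[ℂ] B))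
instance : IsScalarTower ℂ (AlgTensor A B) (AlgTensor A B) :=
  inferInstanceAs (IsScalarTower ℂ (A ⊗[ℂ] B) (A ⊗[ℂ] B))
instance : SMulCommClass ℂ (AlgTensor A B) (AlgTensor A B) :=
  inferInstanceAs (SMulCommClass ℂ (A ⊗[ℂ] B) (A ⊗[ℂ] B))
instance : StarAddMonoid (AlgTensor A B) := inferInstanceAs (StarAddMonoid (A ⊗[ℂ] B))
instance : StarModule ℂ (AlgTensor A B) := inferInstanceAs (StarModule ℂ (A ⊗[ℂ] B))

/-- The elementary tensor `a ⊗ b` in `A ⊙ B`. -/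
def tmul (a : A) (b : B) : AlgTensor A B := a ⊗ₜ[ℂ] b

theorem tmul_mul_tmul (a c : A) (b d : B) : tmul a b * tmul c d = tmul (a * c) (b * d) :=
  Algebra.TensorProduct.tmul_mul_tmul a c b d

theorem star_tmul (a : A) (b : B) : star (tmul a b) = tmul (star a) (star b) := rfl

@[elab_as_elim]
theorem induction_on {p : AlgTensor A B → Prop} (t : AlgTensor A B) (zero : p 0)
    (tmul : ∀ a b, p (tmul a b)) (add : ∀ x y, p x → p y → p (x + y)) : p t :=
  TensorProduct.induction_on (motive := p) t zero tmul add

instance : StarRing (AlgTensor A B) where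
  star_mul := star_mul_tensor
  star_add := star_add

instance : SeminormedAddCommGroup (AlgTensor A B) :=
  AddGroupSeminorm.toSeminormedAddCommGroup
    { toFun := fun t : A ⊗[ℂ] B => minNorm t
      map_zero' := minNorm_zero
      add_le' := minNorm_add_le
      neg' := minNorm_neg }

theorem norm_def (t : AlgTensor A B) : ‖t‖ = minNorm (A := A) (B := B) t := rfl

instance : NonUnitalSeminormedRing (AlgTensor A B) where
  __ := (inferInstance : NonUnitalRing (AlgTensor A B))
  __ := (inferInstance : SeminormedAddCommGroup (AlgTensor A B))
  norm_mul_le := minNorm_mul_le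

instance : NormedSpace ℂ (AlgTensor A B) where
  norm_smul_le := minNorm_smul_le

instance : NormedStarGroup (AlgTensor A B) where
  norm_star_le := minNorm_star_le

/-- The algebraic tensor product `f ⊙ g` of two ⋆-homomorphisms. -/
def map {A₁ A₂ : Type u} {B₁ B₂ : Type v} [NonUnitalCStarAlgebra A₁] [NonUnitalCStarAlgebra A₂]
    [NonUnitalCStarAlgebra B₁] [NonUnitalCStarAlgebra B₂]
    (f : A₁ →⋆ₙₐ[ℂ] A₂) (g : B₁ →⋆ₙₐ[ℂ] B₂) : AlgTensor A₁ B₁ →ₗ[ℂ] AlgTensor A₂ B₂ :=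
  TensorProduct.map (f : A₁ →ₗ[ℂ] A₂) (g : B₁ →ₗ[ℂ] B₂)

section Map

variable {A₁ A₂ : Type u} {B₁ B₂ : Type v} [NonUnitalCStarAlgebra A₁] [NonUnitalCStarAlgebra A₂]
    [NonUnitalCStarAlgebra B₁] [NonUnitalCStarAlgebra B₂]
    (f : A₁ →⋆ₙₐ[ℂ] A₂) (g : B₁ →⋆ₙₐ[ℂ] B₂)

theorem map_tmul (a : A₁) (b : B₁) : map f g (tmul a b) = tmul (f a) (g b) := rfl

theorem repTensor_map (π : HilbertRep A₂) (ρ : HilbertRep B₂) (t : A₁ ⊗[ℂ] B₁) :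
    repTensor π ρ (TensorProduct.map (f : A₁ →ₗ[ℂ] A₂) (g : B₁ →ₗ[ℂ] B₂) t) =
      repTensor (π.comap f) (ρ.comap g) t := by
  induction t with
  | zero => rw [map_zero, map_zero, map_zero]; rfl
  | add x y hx hy => rw [map_add, map_add, map_add, hx, hy]; rfl
  | tmul a b => rfl

theorem norm_map_le (t : AlgTensor A₁ B₁) : ‖map f g t‖ ≤ ‖t‖ :=
  minNorm_le fun π ρ => (congrArg norm (repTensor_map f g π ρ t)).trans_le (le_minNorm _ _ _)

theorem map_mul' (s t : AlgTensor A₁ B₁) : map f g (s * t) = map f g s * map f g t := by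
  induction s using AlgTensor.induction_on with
  | zero => simp
  | add x y hx hy => rw [add_mul, map_add, map_add, hx, hy, add_mul]
  | tmul a b =>
    induction t using AlgTensor.induction_on with
    | zero => simp
    | add x y hx hy => rw [mul_add, map_add, map_add, hx, hy, mul_add]
    | tmul c d => simp only [tmul_mul_tmul, map_tmul, map_mul]

theorem map_star' (t : AlgTensor A₁ B₁) : map f g (star t) = star (map f g t) := by
  induction t using AlgTensor.induction_on with
  | zero => simp
  | add x y hx hy => rw [star_add, map_add, map_add, hx, hy, star_add]
  | tmul a b => simp only [star_tmul, map_tmul, map_star]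

/-- `f ⊙ g` as a bounded linear map for the spatial norms. -/
def mapL : AlgTensor A₁ B₁ →L[ℂ] AlgTensor A₂ B₂ :=
  (map f g).mkContinuous 1 fun t => by rw [one_mul]; exact norm_map_le f g t

end Map

end AlgTensor

/-- The minimal (spatial) tensor product `A ⊗_min B`: the completion of `A ⊙ B` for the spatial
norm. -/
def MinTensor (A : Type u) (B : Type v) [NonUnitalCStarAlgebra A] [NonUnitalCStarAlgebra B] :
    Type (max u v) :=
  Completion (AlgTensor A B)

namespace MinTensor

variable {A : Type u} {B : Type v} [NonUnitalCStarAlgebra A] [NonUnitalCStarAlgebra B]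

instance : NormedAddCommGroup (MinTensor A B) :=
  inferInstanceAs (NormedAddCommGroup (Completion (AlgTensor A B)))

instance : NormedSpace ℂ (MinTensor A B) :=
  inferInstanceAs (NormedSpace ℂ (Completion (AlgTensor A B)))

instance : CompleteSpace (MinTensor A B) :=
  inferInstanceAs (CompleteSpace (Completion (AlgTensor A B)))

/-- The canonical map `A ⊙ B → A ⊗_min B`. -/
def of : AlgTensor A B →ₗᵢ[ℂ] MinTensor A B := Completion.toComplₗᵢ

/-- The elementary tensor `a ⊗ b` in `A ⊗_min B`. -/
def tmul (a : A) (b : B) : MinTensor A B := of (AlgTensor.tmul a b)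

theorem isDenseInducing_of : IsDenseInducing (of : AlgTensor A B → MinTensor A B) :=
  Completion.isDenseInducing_coe

theorem continuous_of : Continuous (of : AlgTensor A B → MinTensor A B) :=
  Completion.continuous_coe _

theorem induction_on {p : MinTensor A B → Prop} (x : MinTensor A B)
    (hp : IsClosed {x | p x}) (ih : ∀ t : AlgTensor A B, p (of t)) : p x :=
  Completion.induction_on x hp ih

/-- The multiplication of `A ⊗_min B` is the continuous extension of that of `A ⊙ B`. -/
instance : Mul (MinTensor A B) where
  mul x y := (isDenseInducing_of.prodMap isDenseInducing_of).extend
    (fun p : AlgTensor A B × AlgTensor A B => of (p.1 * p.2)) (x, y)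

/-- The involution of `A ⊗_min B` is the continuous extension of that of `A ⊙ B`. -/
instance : Star (MinTensor A B) where
  star := isDenseInducing_of.extend fun t : AlgTensor A B => of (star t)

theorem of_mul (s t : AlgTensor A B) : of (s * t) = of s * of t :=
  ((isDenseInducing_of.prodMap isDenseInducing_of).extend_eq
    (continuous_of.comp continuous_mul) (s, t)).symm

instance : ContinuousMul (MinTensor A B) where
  continuous_mul := by
    let m := (AddMonoidHom.mul : AlgTensor A B →+ AlgTensor A B →+ AlgTensor A B).compr₂
      (of : AlgTensor A B →ₗᵢ[ℂ] MinTensor A B).toLinearMap.toAddMonoidHom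
    have hm : Continuous fun p : AlgTensor A B × AlgTensor A B => m p.1 p.2 :=
      continuous_of.comp continuous_mul
    have di : IsDenseInducing
      ((of : AlgTensor A B →ₗᵢ[ℂ] MinTensor A B).toLinearMap.toAddMonoidHom) := isDenseInducing_of
    exact (di.extend_Z_bilin di hm :)

theorem of_star (t : AlgTensor A B) : of (star t) = star (of t) :=
  (isDenseInducing_of.extend_eq (continuous_of.comp continuous_star) t).symm

instance : ContinuousStar (MinTensor A B) where
  continuous_star := by
    have h : UniformContinuous fun t : AlgTensor A B => (of (star t) : MinTensor A B) :=
      (of : AlgTensor A B →ₗᵢ[ℂ] MinTensor A B).isometry.uniformContinuous.comp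
        (starₗᵢ ℂ : AlgTensor A B ≃ₗᵢ⋆[ℂ] AlgTensor A B).isometry.uniformContinuous
    exact (uniformContinuous_uniformly_extend
      (Completion.isUniformInducing_coe (AlgTensor A B)) Completion.denseRange_coe h).continuous

theorem induction_on₂ {p : MinTensor A B → MinTensor A B → Prop} (x y : MinTensor A B)
    (hp : IsClosed {q : MinTensor A B × MinTensor A B | p q.1 q.2})
    (ih : ∀ s t : AlgTensor A B, p (of s) (of t)) : p x y :=
  Completion.induction_on₂ x y hp ih

theorem induction_on₃ {p : MinTensor A B → MinTensor A B → MinTensor A B → Prop}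
    (x y z : MinTensor A B)
    (hp : IsClosed {q : MinTensor A B × MinTensor A B × MinTensor A B | p q.1 q.2.1 q.2.2})
    (ih : ∀ r s t : AlgTensor A B, p (of r) (of s) (of t)) : p x y z :=
  Completion.induction_on₃ x y z hp ih

instance : NonUnitalNormedRing (MinTensor A B) where
  __ := (inferInstance : NormedAddCommGroup (MinTensor A B))
  __ := (inferInstance : Mul (MinTensor A B))
  left_distrib x y z := by
    induction x, y, z using induction_on₃ with
    | hp => exact isClosed_eq (by fun_prop) (by fun_prop)
    | ih r s t => rw [← map_add, ← of_mul, ← of_mul, ← of_mul, ← map_add, mul_add]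
  right_distrib x y z := by
    induction x, y, z using induction_on₃ with
    | hp => exact isClosed_eq (by fun_prop) (by fun_prop)
    | ih r s t => rw [← map_add, ← of_mul, ← of_mul, ← of_mul, ← map_add, add_mul]
  zero_mul x := by
    induction x using induction_on with
    | hp => exact isClosed_eq (by fun_prop) (by fun_prop)
    | ih t => rw [← map_zero of, ← of_mul, zero_mul]
  mul_zero x := by
    induction x using induction_on with
    | hp => exact isClosed_eq (by fun_prop) (by fun_prop)
    | ih t => rw [← map_zero of, ← of_mul, mul_zero]
  mul_assoc x y z := by
    induction x, y, z using induction_on₃ with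
    | hp => exact isClosed_eq (by fun_prop) (by fun_prop)
    | ih r s t => rw [← of_mul, ← of_mul, ← of_mul, ← of_mul, mul_assoc]
  norm_mul_le x y := by
    induction x, y using induction_on₂ with
    | hp => exact isClosed_le (by fun_prop) (by fun_prop)
    | ih s t =>
      rw [← of_mul, of.norm_map, of.norm_map, of.norm_map]
      exact norm_mul_le s t

instance : StarRing (MinTensor A B) where
  star_involutive x := by
    induction x using induction_on with
    | hp => exact isClosed_eq (by fun_prop) (by fun_prop)
    | ih t => rw [← of_star, ← of_star, star_star]
  star_mul x y := by
    induction x, y using induction_on₂ with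
    | hp => exact isClosed_eq (by fun_prop) (by fun_prop)
    | ih s t => rw [← of_mul, ← of_star, ← of_star, ← of_star, ← of_mul, star_mul]
  star_add x y := by
    induction x, y using induction_on₂ with
    | hp => exact isClosed_eq (by fun_prop) (by fun_prop)
    | ih s t => rw [← map_add, ← of_star, ← of_star, ← of_star, ← map_add, star_add]

theorem continuous_smul_min (c : ℂ) : Continuous fun x : MinTensor A B => c • x :=
  (lipschitzWith_smul c).continuous

theorem smul_mul_min (c : ℂ) (x y : MinTensor A B) : (c • x) * y = c • (x * y) := by
  induction x, y using induction_on₂ with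
  | hp =>
    exact isClosed_eq (((continuous_smul_min c).comp continuous_fst).mul continuous_snd)
      ((continuous_smul_min c).comp (continuous_fst.mul continuous_snd))
  | ih s t => rw [← map_smul, ← of_mul, ← of_mul, ← map_smul, smul_mul_assoc]

theorem mul_smul_min (c : ℂ) (x y : MinTensor A B) : x * (c • y) = c • (x * y) := by
  induction x, y using induction_on₂ with
  | hp =>
    exact isClosed_eq (continuous_fst.mul ((continuous_smul_min c).comp continuous_snd))
      ((continuous_smul_min c).comp (continuous_fst.mul continuous_snd))
  | ih s t => rw [← map_smul, ← of_mul, ← of_mul, ← map_smul, mul_smul_comm]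

instance : IsScalarTower ℂ (MinTensor A B) (MinTensor A B) := ⟨smul_mul_min⟩

instance : SMulCommClass ℂ (MinTensor A B) (MinTensor A B) :=
  ⟨fun c x y => (mul_smul_min c x y).symm⟩

instance : StarModule ℂ (MinTensor A B) where
  star_smul c x := by
    induction x using induction_on with
    | hp =>
      exact isClosed_eq (continuous_star.comp (continuous_smul_min c))
        ((continuous_smul_min (star c)).comp continuous_star)
    | ih t => rw [← map_smul, ← of_star, ← of_star, ← map_smul, star_smul]

instance : CStarRing (MinTensor A B) where
  norm_mul_self_le x := by
    induction x using induction_on with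
    | hp => exact isClosed_le (by fun_prop) (by fun_prop)
    | ih t =>
      rw [← of_star, ← of_mul, of.norm_map, of.norm_map]
      exact minNorm_sq_le (A := A) (B := B) t

/-- `A ⊗_min B` is a C⋆-algebra. -/
instance : NonUnitalCStarAlgebra (MinTensor A B) where

section Map

variable {A₁ A₂ : Type u} {B₁ B₂ : Type v} [NonUnitalCStarAlgebra A₁] [NonUnitalCStarAlgebra A₂]
    [NonUnitalCStarAlgebra B₁] [NonUnitalCStarAlgebra B₂]
    (f : A₁ →⋆ₙₐ[ℂ] A₂) (g : B₁ →⋆ₙₐ[ℂ] B₂)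

/-- `f ⊗_min g` as a bounded linear map. -/
def mapL : MinTensor A₁ B₁ →L[ℂ] MinTensor A₂ B₂ := (AlgTensor.mapL f g).completion

theorem mapL_of (t : AlgTensor A₁ B₁) : mapL f g (of t) = of (AlgTensor.map f g t) :=
  ContinuousLinearMap.completion_apply_coe (AlgTensor.mapL f g) t

/-- The ⋆-homomorphism `f ⊗_min g`, the one with `(f ⊗_min g) (a ⊗ b) = f a ⊗ g b`. -/
def map : MinTensor A₁ B₁ →⋆ₙₐ[ℂ] MinTensor A₂ B₂ where
  toFun := mapL f g
  map_smul' c x := map_smul (mapL f g) c x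
  map_zero' := map_zero (mapL f g)
  map_add' := map_add (mapL f g)
  map_mul' x y := by
    induction x, y using induction_on₂ with
    | hp => exact isClosed_eq (by fun_prop) (by fun_prop)
    | ih s t => rw [← of_mul, mapL_of, mapL_of, mapL_of, ← of_mul, AlgTensor.map_mul']
  map_star' x := by
    induction x using induction_on with
    | hp => exact isClosed_eq (by fun_prop) (by fun_prop)
    | ih t => rw [← of_star, mapL_of, mapL_of, ← of_star, AlgTensor.map_star']

theorem map_tmul (a : A₁) (b : B₁) : map f g (tmul a b) = tmul (f a) (g b) :=
  mapL_of f g _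

end Map

end MinTensor

end CStarTensor

/-! ### Exact C⋆-algebras -/

/-- `0 → A → B → C → 0` is a short exact sequence of C⋆-algebras. -/
structure IsShortExactCStar {A B C : Type*} [NonUnitalCStarAlgebra A] [NonUnitalCStarAlgebra B]
    [NonUnitalCStarAlgebra C] (i : A →⋆ₙₐ[ℂ] B) (p : B →⋆ₙₐ[ℂ] C) : Prop where
  injective : Function.Injective i
  exact : Function.Exact i p
  surjective : Function.Surjective p

/-- The C⋆-algebra `D` is exact: for every short exact sequence `0 → A → B → C → 0` of
C⋆-algebras, the sequence `0 → A ⊗_min D → B ⊗_min D → C ⊗_min D → 0` is exact. -/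
def IsExactCStarAlgebra (D : Type u) [NonUnitalCStarAlgebra D] : Prop :=
  ∀ (A B C : Type v) [NonUnitalCStarAlgebra A] [NonUnitalCStarAlgebra B]
    [NonUnitalCStarAlgebra C] (i : A →⋆ₙₐ[ℂ] B) (p : B →⋆ₙₐ[ℂ] C),
    IsShortExactCStar i p →
      IsShortExactCStar (CStarTensor.MinTensor.map i (NonUnitalStarAlgHom.id ℂ D))
        (CStarTensor.MinTensor.map p (NonUnitalStarAlgHom.id ℂ D))

/-! ### Graded C⋆-algebras -/

/-- A grading of the C⋆-algebra `𝔄` by the semilattice `L`: a linearly independent and total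
family of C⋆-subalgebras (the components) with `A i * A j ⊆ A (i ⊓ j)`. -/
structure CStarGrading (L : Type w) [SemilatticeInf L] (𝔄 : Type u)
    [NonUnitalCStarAlgebra 𝔄] where
  /-- the components -/
  component : L → NonUnitalStarSubalgebra ℂ 𝔄
  isClosed : ∀ i, IsClosed (component i : Set 𝔄)
  independent : iSupIndep fun i => (component i).toNonUnitalSubalgebra.toSubmodule
  total : Dense (Submodule.span ℂ (⋃ i, (component i : Set 𝔄)) : Set 𝔄)
  mul_mem : ∀ i j, ∀ a ∈ component i, ∀ b ∈ component j, a * b ∈ component (i ⊓ j)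

instance {L : Type w} [SemilatticeInf L] {𝔄 : Type u} [NonUnitalCStarAlgebra 𝔄]
    (G : CStarGrading L 𝔄) (i : L) : IsClosed (G.component i : Set 𝔄) :=
  G.isClosed i

end

/-! ### Gelfand-Naimark: representations separate points -/

section GelfandNaimark

open scoped ComplexOrder

/-! Exactness of `𝔄` passes to the components because it passes to C⋆-subalgebras
(`IsExactCStarAlgebra.of_injective`): an element of the kernel of `p ⊗ 1` over the subalgebra comes
from `A` over the larger algebra, hence is a limit of its multiples by an approximate unit of `A`,
and these come from `A` over the subalgebra.

Conversely, let `F` be a finite subsemilattice of `L` and `i` maximal in `F`. The sum `I` of the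
components over `F \ {i}` absorbs multiplication by `A i`, and `A i ∩ I = 0` by independence, so `A
i + I` is a split extension of `A i` by `I`. By induction on `F` these finite sums are closed and
exact, since split extensions preserve exactness (`IsExactCStarAlgebra.of_split`). A finite set
generates a finite subsemilattice, so the sums form a directed family with dense union, and
exactness passes to the closure (`IsExactCStarAlgebra.of_directed_dense`).

Two facts about C⋆-algebras carry this. The spatial norm is inherited by subalgebras in either
variable (`minNorm_map_left`, `minNorm_map_right`), so injective maps stay isometric after
tensoring. The quotient norm along a ⋆-homomorphism is attained on kernels
(`exists_ker_norm_sub_le`), which gives closed ranges and the approximation argument for directed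
unions. -/

theorem CStarAlgebra.exists_positiveLinearMap_pos {B : Type*} [NonUnitalCStarAlgebra B]
    [PartialOrder B] [StarOrderedRing B] {z : B} (hz : 0 ≤ z) (hz0 : z ≠ 0) :
    ∃ F : B →ₚ[ℂ] ℂ, 0 < F z := by
  let C : ProperCone ℝ B :=
    { carrier := {b | 0 ≤ b}
      add_mem' := fun ha hb => add_nonneg ha hb
      zero_mem' := le_refl (0 : B)
      smul_mem' := fun c _ hb => smul_nonneg c.2 hb
      isClosed' := CStarAlgebra.isClosed_nonneg }
  -- The functional comes from separating `-z` from the closed cone of positive elements.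
  have hC : -z ∉ C := fun h => hz0 (le_antisymm (neg_nonneg.mp h) hz)
  obtain ⟨f, hf, hfz⟩ := C.hyperplane_separation_point hC
  replace hf : ∀ b : B, 0 ≤ b → 0 ≤ f b := fun b hb => hf b hb
  have hfz : 0 < f z := by simpa using hfz
  -- Symmetrizing under the involution makes `g` vanish on `I • b` for selfadjoint `b`, so its
  -- complex extension is real on positive elements.
  let g : Module.Dual ℝ B :=
    { toFun := fun b => (f b + f (star b)) / 2
      map_add' := fun a b => by simp only [star_add, map_add]; ring
      map_smul' := fun c b => by
        simp only [star_smul, map_smul, star_trivial, smul_eq_mul, RingHom.id_apply]; ring }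
  have hg : ∀ b : B, 0 ≤ b → g.extendRCLike b = ((f b : ℝ) : ℂ) := fun b hb => by
    have hb' : star b = b := (IsSelfAdjoint.of_nonneg hb).star_eq
    rw [Module.Dual.extendRCLike_apply]
    have h1 : g b = f b := by simp [g, hb']
    have h2 : g (Complex.I • b) = 0 := by simp [g, hb', star_smul]
    simp [h1, h2]
  refine ⟨PositiveLinearMap.mk₀ g.extendRCLike fun b hb => ?_, ?_⟩
  · rw [hg b hb]; exact_mod_cast hf b hb
  · change 0 < g.extendRCLike z
    rw [hg z hz]; exact_mod_cast hfz

namespace CStarTensor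

/-- GNS construction. Without a unit there is no evident cyclic vector, so `π x` is tested on the
class of `b = x⋆x`: the square of the norm of `π x b` is `F ((x b)⋆ (x b))`, positive for a suitable
`F` because `x b ≠ 0`. -/
theorem HilbertRep.exists_hom_ne_zero {B : Type u} [NonUnitalCStarAlgebra B] {x : B}
    (hx : x ≠ 0) : ∃ π : HilbertRep B, π.hom x ≠ 0 := by
  let := CStarAlgebra.spectralOrder B
  have := CStarAlgebra.spectralOrderedRing B
  have hy : star x * x ≠ 0 := fun h => hx (CStarRing.star_mul_self_eq_zero_iff x |>.mp h)
  have hxy : x * (star x * x) ≠ 0 := fun h => by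
    have h2 : star (star x * x) * (star x * x) = 0 := by
      rw [star_mul, star_star, mul_assoc, h, mul_zero]
    exact hy (CStarRing.star_mul_self_eq_zero_iff _ |>.mp h2)
  set b := star x * x
  have hz : star (x * b) * (x * b) ≠ 0 := fun h =>
    hxy (CStarRing.star_mul_self_eq_zero_iff _ |>.mp h)
  obtain ⟨F, hF⟩ := CStarAlgebra.exists_positiveLinearMap_pos (star_mul_self_nonneg (x * b)) hz
  refine ⟨{ space := F.GNS, hom := F.gnsNonUnitalStarAlgHom }, fun h => hF.ne' ?_⟩
  have h1 : F.gnsNonUnitalStarAlgHom x (F.toPreGNS b : F.GNS) = 0 := by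
    change F.gnsNonUnitalStarAlgHom x = 0 at h
    rw [h]; rfl
  rw [PositiveLinearMap.gnsNonUnitalStarAlgHom_apply_coe, ← norm_eq_zero,
    UniformSpace.Completion.norm_coe] at h1
  have h2 := F.preGNS_norm_sq (F.toPreGNS (x * b))
  have h3 : F.leftMulMapPreGNS x (F.toPreGNS b) = F.toPreGNS (x * b) := rfl
  rw [← h3, h1] at h2
  simpa using h2.symm

end CStarTensor

end GelfandNaimark

/-! ### Jointly injective families of ⋆-homomorphisms -/

/-- Together the `f i` form one injective ⋆-homomorphism into the bounded product of the `Y i`, and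
injective ⋆-homomorphisms are isometric. -/
theorem NonUnitalStarAlgHom.norm_le_of_forall_norm_apply_le {X : Type*} [NonUnitalCStarAlgebra X]
    {I : Type*} {Y : I → Type*} [∀ i, NonUnitalCStarAlgebra (Y i)]
    (f : ∀ i, X →⋆ₙₐ[ℂ] Y i) (hf : ∀ x, (∀ i, f i x = 0) → x = 0) {x : X} {C : ℝ} (hC : 0 ≤ C)
    (h : ∀ i, ‖f i x‖ ≤ C) : ‖x‖ ≤ C := by
  have hmem : ∀ x, Memℓp (fun i => f i x) ⊤ := fun x => memℓp_infty ⟨‖x‖, by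
    rintro _ ⟨i, rfl⟩; exact NonUnitalStarAlgHom.norm_apply_le (f i) x⟩
  let F : X →⋆ₙₐ[ℂ] lp Y ⊤ :=
    { toFun := fun x => ⟨fun i => f i x, hmem x⟩
      map_smul' := fun c x => by ext i; exact map_smul (f i) c x
      map_zero' := by ext i; exact map_zero (f i)
      map_add' := fun x y => by ext i; exact map_add (f i) x y
      map_mul' := fun x y => by ext i; exact map_mul (f i) x y
      map_star' := fun x => by ext i; exact map_star (f i) x }
  have hF : Function.Injective F := (injective_iff_map_eq_zero F).mpr fun x hx =>
    hf x fun i => congrArg (fun g : lp Y ⊤ => g i) hx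
  rw [← NonUnitalStarAlgHom.norm_map F hF x]
  exact lp.norm_le_of_forall_le hC h

namespace CStarTensor

/-! ### Compressions of operators on a Hilbert tensor product -/

section OperatorNorm

variable {H K : Type*} [NormedAddCommGroup H] [InnerProductSpace ℂ H]
  [NormedAddCommGroup K] [InnerProductSpace ℂ K]

theorem opTensor_sum_left {ι : Type*} (s : Finset ι) (S : ι → H →L[ℂ] H) (T : K →L[ℂ] K) :
    opTensor (∑ i ∈ s, S i) T = ∑ i ∈ s, opTensor (S i) T := by
  change opTensorBilin (∑ i ∈ s, S i) T = _
  rw [map_sum, LinearMap.sum_apply]; rfl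

theorem opTensor_sum_right {ι : Type*} (s : Finset ι) (S : H →L[ℂ] H) (T : ι → K →L[ℂ] K) :
    opTensor S (∑ i ∈ s, T i) = ∑ i ∈ s, opTensor S (T i) :=
  map_sum (opTensorBilin S) T s

/-- Every algebraic tensor is fixed by `1 ⊗ P` for the orthogonal projection `P` to a
finite-dimensional subspace. -/
theorem exists_opTensor_starProjection_eq (x y : H ⊗[ℂ] K) :
    ∃ (W : Submodule ℂ K) (_ : FiniteDimensional ℂ W),
      opTensor (1 : H →L[ℂ] H) W.starProjection (HilbertTensor.of H K x) =
          HilbertTensor.of H K x ∧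
        opTensor (1 : H →L[ℂ] H) W.starProjection (HilbertTensor.of H K y) =
          HilbertTensor.of H K y := by
  have key : ∀ x : H ⊗[ℂ] K, ∃ s : Finset K, ∀ P : K →L[ℂ] K, (∀ k ∈ s, P k = k) →
      TensorProduct.mapL (1 : H →L[ℂ] H) P x = x := fun x => by
    classical
    induction x with
    | zero => exact ⟨∅, fun P _ => map_zero _⟩
    | add a b ha hb =>
      obtain ⟨s, hs⟩ := ha
      obtain ⟨t, ht⟩ := hb
      exact ⟨s ∪ t, fun P hP => by
        rw [map_add, hs P fun k hk => hP k (Finset.mem_union_left _ hk),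
          ht P fun k hk => hP k (Finset.mem_union_right _ hk)]⟩
    | tmul h k =>
      exact ⟨{k}, fun P hP => by simp [hP k (Finset.mem_singleton_self k)]⟩
  classical
  obtain ⟨s, hs⟩ := key x
  obtain ⟨t, ht⟩ := key y
  have hW : FiniteDimensional ℂ (Submodule.span ℂ ((s ∪ t : Finset K) : Set K)) :=
    FiniteDimensional.span_finset ℂ _
  have hP : ∀ k ∈ s ∪ t,
      (Submodule.span ℂ ((s ∪ t : Finset K) : Set K)).starProjection k = k := fun k hk =>
    Submodule.starProjection_eq_self_iff.mpr (Submodule.subset_span hk)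
  refine ⟨Submodule.span ℂ ((s ∪ t : Finset K) : Set K), hW, ?_, ?_⟩
  · rw [opTensor_of, hs _ fun k hk => hP k (Finset.mem_union_left _ hk)]
  · rw [opTensor_of, ht _ fun k hk => hP k (Finset.mem_union_right _ hk)]

theorem norm_opTensor_one_starProjection_le (W : Submodule ℂ K) [W.HasOrthogonalProjection] :
    ‖opTensor (1 : H →L[ℂ] H) W.starProjection‖ ≤ 1 := by
  refine (opTensor_norm_le _ _).trans (mul_le_one₀ ?_ (norm_nonneg _) ?_)
  · exact ContinuousLinearMap.norm_id_le
  · exact W.starProjection_norm_le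

theorem star_opTensor_one_starProjection [CompleteSpace H] [CompleteSpace K] (W : Submodule ℂ K)
    [W.HasOrthogonalProjection] :
    star (opTensor (1 : H →L[ℂ] H) W.starProjection) =
      opTensor (1 : H →L[ℂ] H) W.starProjection := by
  rw [← opTensor_star, star_one, (isSelfAdjoint_starProjection W).star_eq]

/-- The norm of an operator on `H ⊗ K` is determined by its compressions to `H ⊗ W`, for `W` a
finite-dimensional subspace of `K`. -/
theorem norm_le_of_compression_le [CompleteSpace H] [CompleteSpace K]
    {T : HilbertTensor H K →L[ℂ] HilbertTensor H K} {C : ℝ} (hC : 0 ≤ C)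
    (h : ∀ (W : Submodule ℂ K) [FiniteDimensional ℂ W],
      ‖opTensor (1 : H →L[ℂ] H) W.starProjection * T *
        opTensor (1 : H →L[ℂ] H) W.starProjection‖ ≤ C) : ‖T‖ ≤ C := by
  have hin : ∀ y x : HilbertTensor H K, ‖inner ℂ y (T x)‖ ≤ C * ‖x‖ * ‖y‖ := fun y x => by
    induction y using HilbertTensor.induction_on with
    | hp => exact isClosed_le (by fun_prop) (by fun_prop)
    | ih y =>
      induction x using HilbertTensor.induction_on with
      | hp => exact isClosed_le (by fun_prop) (by fun_prop)
      | ih x =>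
        obtain ⟨W, hW, hx, hy⟩ := exists_opTensor_starProjection_eq x y
        have hst := star_opTensor_one_starProjection (H := H) W
        set P := opTensor (1 : H →L[ℂ] H) W.starProjection
        -- Both vectors are fixed by the selfadjoint `P`, so the coefficient of `T` is that of its
        -- compression.
        have h1 : inner ℂ (HilbertTensor.of H K y) (T (HilbertTensor.of H K x)) =
            inner ℂ (HilbertTensor.of H K y) ((P * T * P) (HilbertTensor.of H K x)) := by
          change _ = inner ℂ _ (P (T (P _)))
          rw [hx, ← ContinuousLinearMap.adjoint_inner_left P,
            ← ContinuousLinearMap.star_eq_adjoint, hst, hy]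
        rw [h1, mul_comm]
        refine (norm_inner_le_norm _ _).trans ?_
        gcongr
        exact (ContinuousLinearMap.le_opNorm _ _).trans (by gcongr; exact h W)
  refine T.opNorm_le_bound hC fun x => ?_
  rcases (norm_nonneg (T x)).eq_or_lt with h0 | h0
  · rw [← h0]; positivity
  · have := hin (T x) x
    rw [inner_self_eq_norm_sq_to_K] at this
    refine le_of_mul_le_mul_right ?_ h0
    simpa [sq] using this

end OperatorNorm

/-! ### Slice maps and matrix amplifications -/

section Slices

variable {A : Type u} {D : Type v} [NonUnitalCStarAlgebra A] [NonUnitalCStarAlgebra D]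
  {n : Type w}

/-- The matrix amplification of a representation of `A`: the matrix `M` over `A` acts on `H ⊗ K`
as `∑ i j, π (M i j) ⊗ |e i⟩⟨e j|`. -/
noncomputable def matrixRep [Fintype n] (π : HilbertRep A) {K : Type*} [NormedAddCommGroup K]
    [InnerProductSpace ℂ K] [CompleteSpace K] {e : n → K} (he : Orthonormal ℂ e) :
    CStarMatrix n n A →⋆ₙₐ[ℂ] (HilbertTensor π.space K →L[ℂ] HilbertTensor π.space K) where
  toFun M := ∑ i, ∑ j, opTensor (π.hom (M i j)) (InnerProductSpace.rankOne ℂ (e i) (e j))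
  map_smul' c M := by
    simp [Finset.smul_sum, opTensor_smul_left]
  map_zero' := by
    have : ∀ T : K →L[ℂ] K, opTensor (0 : π.space →L[ℂ] π.space) T = 0 := fun T =>
      LinearMap.map_zero₂ opTensorBilin T
    simp [this]
  map_add' M N := by
    simp [Finset.sum_add_distrib, opTensor_add_left]
  map_mul' M N := by
    classical
    -- Orthonormality turns the rank-one operators into matrix units.
    have hE : ∀ i j k l, InnerProductSpace.rankOne ℂ (e i) (e j) *
        InnerProductSpace.rankOne ℂ (e k) (e l) =
        if j = k then InnerProductSpace.rankOne ℂ (e i) (e l) else 0 := fun i j k l => by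
      rw [ContinuousLinearMap.mul_def, InnerProductSpace.rankOne_comp_rankOne,
        orthonormal_iff_ite.mp he]
      split_ifs <;> simp
    have h0 : ∀ S : π.space →L[ℂ] π.space, opTensor S (0 : K →L[ℂ] K) = 0 := fun S =>
      map_zero (opTensorBilin S)
    simp only [Finset.sum_mul, Finset.mul_sum, ← opTensor_mul, hE, CStarMatrix.mul_apply, map_sum,
      map_mul, opTensor_sum_left]
    simp only [apply_ite (opTensor _), h0, Finset.sum_ite_eq', Finset.mem_univ, if_true]
    calc _ = ∑ i, ∑ k, ∑ j, opTensor (π.hom (M i k) * π.hom (N k j))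
          (InnerProductSpace.rankOne ℂ (e i) (e j)) :=
          Finset.sum_congr rfl fun i _ => Finset.sum_comm
      _ = ∑ k, ∑ i, ∑ j, opTensor (π.hom (M i k) * π.hom (N k j))
          (InnerProductSpace.rankOne ℂ (e i) (e j)) := Finset.sum_comm
      _ = _ := Finset.sum_congr rfl fun k _ => Finset.sum_comm
  map_star' M := by
    simp only [star_sum, ← opTensor_star, CStarMatrix.star_apply, map_star]
    rw [Finset.sum_comm]
    simp [ContinuousLinearMap.star_eq_adjoint]

theorem matrixRep_apply [Fintype n] (π : HilbertRep A) {K : Type*} [NormedAddCommGroup K]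
    [InnerProductSpace ℂ K] [CompleteSpace K] {e : n → K} (he : Orthonormal ℂ e)
    (M : CStarMatrix n n A) :
    matrixRep π he M =
      ∑ i, ∑ j, opTensor (π.hom (M i j)) (InnerProductSpace.rankOne ℂ (e i) (e j)) := rfl

theorem hom_apply_eq_zero_of_matrixRep [Fintype n] (π : HilbertRep A) {K : Type*}
    [NormedAddCommGroup K] [InnerProductSpace ℂ K] [CompleteSpace K] {e : n → K}
    (he : Orthonormal ℂ e) {M : CStarMatrix n n A} (h : matrixRep π he M = 0) (k l : n) :
    π.hom (M k l) = 0 := by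
  classical
  ext x
  refine ext_inner_left ℂ fun y => ?_
  have h1 : inner ℂ (HilbertTensor.of π.space K (y ⊗ₜ e k))
      (matrixRep π he M (HilbertTensor.of π.space K (x ⊗ₜ e l))) = 0 := by simp [h]
  simp only [matrixRep_apply, sum_apply, opTensor_of_tmul, inner_sum, LinearIsometry.inner_map_map,
    TensorProduct.inner_tmul, InnerProductSpace.rankOne_apply, inner_smul_right,
    orthonormal_iff_ite.mp he] at h1
  simpa using h1

/-- The slice map `a ⊗ d ↦ φ d • a`. -/
noncomputable def slice (φ : D →ₗ[ℂ] ℂ) : A ⊗[ℂ] D →ₗ[ℂ] A :=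
  (TensorProduct.rid ℂ A).toLinearMap ∘ₗ φ.lTensor A

@[simp]
theorem slice_tmul (φ : D →ₗ[ℂ] ℂ) (a : A) (d : D) : slice φ (a ⊗ₜ[ℂ] d) = φ d • a := rfl

theorem slice_map {B : Type u} [NonUnitalCStarAlgebra B] (φ : D →ₗ[ℂ] ℂ) (ι : A →⋆ₙₐ[ℂ] B)
    (t : A ⊗[ℂ] D) :
    slice φ (TensorProduct.map (ι : A →ₗ[ℂ] B)
      ((NonUnitalStarAlgHom.id ℂ D : D →⋆ₙₐ[ℂ] D) : D →ₗ[ℂ] D) t) = ι (slice φ t) := by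
  induction t with
  | zero => simp
  | add x y hx hy => simp only [map_add, hx, hy]
  | tmul a d => simp

/-- The matrix of slices of `t ∈ A ⊙ D` by the coefficient functionals `⟪e i, ρ (·) (e j)⟫`. -/
noncomputable def sliceMatrix (ρ : HilbertRep D) (e : n → ρ.space) (t : A ⊗[ℂ] D) : CStarMatrix n n A :=
  CStarMatrix.ofMatrix fun i j =>
    slice ((innerSL ℂ (e i) : ρ.space →ₗ[ℂ] ℂ) ∘ₗ (ContinuousLinearMap.apply ℂ ρ.space (e j) :
      (ρ.space →L[ℂ] ρ.space) →ₗ[ℂ] ρ.space) ∘ₗ (ρ.hom : D →ₗ[ℂ] (ρ.space →L[ℂ] ρ.space))) t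

theorem sliceMatrix_apply (ρ : HilbertRep D) (e : n → ρ.space) (t : A ⊗[ℂ] D) (i j : n) :
    sliceMatrix ρ e t i j =
    slice ((innerSL ℂ (e i) : ρ.space →ₗ[ℂ] ℂ) ∘ₗ (ContinuousLinearMap.apply ℂ ρ.space (e j) :
      (ρ.space →L[ℂ] ρ.space) →ₗ[ℂ] ρ.space) ∘ₗ (ρ.hom : D →ₗ[ℂ] (ρ.space →L[ℂ] ρ.space))) t :=
  rfl

theorem sliceMatrix_zero (ρ : HilbertRep D) (e : n → ρ.space) :
    sliceMatrix ρ e (0 : A ⊗[ℂ] D) = 0 := by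
  ext i j; simp [sliceMatrix_apply]

theorem sliceMatrix_add (ρ : HilbertRep D) (e : n → ρ.space) (s t : A ⊗[ℂ] D) :
    sliceMatrix ρ e (s + t) = sliceMatrix ρ e s + sliceMatrix ρ e t := by
  ext i j; simp [sliceMatrix_apply]

/-- Compressing to `H ⊗ W` replaces `ρ d` by its finite matrix of coefficients, which are scalars
and can be moved onto `A`. The compressed operator thus depends on `t` only through a matrix over
`A`, with `D` gone. -/
theorem compression_repTensor [Fintype n] (π : HilbertRep A) (ρ : HilbertRep D)
    {W : Submodule ℂ ρ.space} [FiniteDimensional ℂ W] (b : OrthonormalBasis n ℂ W)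
    (t : A ⊗[ℂ] D) :
    opTensor (1 : π.space →L[ℂ] π.space) W.starProjection * repTensor π ρ t *
        opTensor (1 : π.space →L[ℂ] π.space) W.starProjection =
      matrixRep π (b.orthonormal.comp_linearIsometry W.subtypeₗᵢ)
        (sliceMatrix ρ (W.subtypeₗᵢ ∘ b) t) := by
  induction t with
  | zero => rw [map_zero, sliceMatrix_zero, map_zero, mul_zero, zero_mul]
  | add x y hx hy => rw [map_add, sliceMatrix_add, map_add, mul_add, add_mul, hx, hy]
  | tmul a d =>
    have hP : W.starProjection * ρ.hom d * W.starProjection =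
        ∑ i, ∑ j, inner ℂ (b i : ρ.space) (ρ.hom d (b j)) •
          InnerProductSpace.rankOne ℂ (b i : ρ.space) (b j : ρ.space) := by
      rw [b.starProjection_eq_sum_rankOne]
      ext x
      simp only [mul_apply_eq_comp, sum_apply, InnerProductSpace.rankOne_apply, map_sum, map_smul,
        smul_apply, Finset.smul_sum]
      rw [Finset.sum_comm]
      exact Finset.sum_congr rfl fun i _ => Finset.sum_congr rfl fun j _ => smul_comm _ _ _
    rw [repTensor_tmul, ← opTensor_mul, ← opTensor_mul, one_mul, mul_one, hP, matrixRep_apply]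
    simp only [opTensor_sum_right, opTensor_smul_right]
    refine Finset.sum_congr rfl fun i _ => Finset.sum_congr rfl fun j _ => ?_
    simp [sliceMatrix_apply, opTensor_smul_left]

end Slices

/-- The spatial norm is compatible with subalgebras in the first variable. -/
theorem minNorm_map_left {A B : Type u} {D : Type v} [NonUnitalCStarAlgebra A]
    [NonUnitalCStarAlgebra B] [NonUnitalCStarAlgebra D] (ι : A →⋆ₙₐ[ℂ] B)
    (hι : Function.Injective ι) (t : A ⊗[ℂ] D) :
    minNorm t ≤ minNorm (TensorProduct.map (ι : A →ₗ[ℂ] B)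
      ((NonUnitalStarAlgHom.id ℂ D : D →⋆ₙₐ[ℂ] D) : D →ₗ[ℂ] D) t) := by
  let := CStarAlgebra.spectralOrder A
  have := CStarAlgebra.spectralOrderedRing A
  let := CStarAlgebra.spectralOrder B
  have := CStarAlgebra.spectralOrderedRing B
  -- No representation of `A` is extended to `B`: after compression only a matrix over `A` remains,
  -- and the inclusion of matrix algebras is isometric.
  refine minNorm_le fun π ρ => norm_le_of_compression_le (minNorm_nonneg _) fun W _ => ?_
  let b := stdOrthonormalBasis ℂ W
  rw [compression_repTensor π ρ b]
  refine (NonUnitalStarAlgHom.norm_apply_le _ _).trans ?_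
  let ιn : CStarMatrix (Fin (Module.finrank ℂ W)) (Fin (Module.finrank ℂ W)) A →⋆ₙₐ[ℂ]
      CStarMatrix (Fin (Module.finrank ℂ W)) (Fin (Module.finrank ℂ W)) B :=
    { toFun := fun M => M.map ι
      map_smul' := fun c M => by ext i j; simp
      map_zero' := by ext i j; simp
      map_add' := fun M N => by ext i j; simp
      map_mul' := fun M N => by ext i j; simp [CStarMatrix.mul_apply]
      map_star' := fun M => by ext i j; simp [CStarMatrix.star_apply, map_star] }
  rw [← NonUnitalStarAlgHom.norm_map ιn (CStarMatrix.map_injective hι)]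
  -- The norm of a matrix over `B` is detected by amplified representations of `B`, which are
  -- jointly injective by Gelfand–Naimark.
  refine NonUnitalStarAlgHom.norm_le_of_forall_norm_apply_le
    (fun π' : HilbertRep B => matrixRep π' (b.orthonormal.comp_linearIsometry W.subtypeₗᵢ))
    (fun M hM => ?_) (minNorm_nonneg _) fun π' => ?_
  · ext i j
    by_contra hne
    obtain ⟨π', hπ'⟩ := HilbertRep.exists_hom_ne_zero hne
    exact hπ' (hom_apply_eq_zero_of_matrixRep π' _ (hM π') i j)
  · have h1 : ιn (sliceMatrix ρ (W.subtypeₗᵢ ∘ b) t) = sliceMatrix ρ (W.subtypeₗᵢ ∘ b)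
        (TensorProduct.map (ι : A →ₗ[ℂ] B)
          ((NonUnitalStarAlgHom.id ℂ D : D →⋆ₙₐ[ℂ] D) : D →ₗ[ℂ] D) t) := by
      ext i j
      exact (slice_map _ ι t).symm
    rw [h1, ← compression_repTensor π' ρ b]
    have hP := norm_opTensor_one_starProjection_le (H := π'.space) W
    refine (norm_mul_le _ _).trans ((mul_le_of_le_one_right (norm_nonneg _) hP).trans ?_)
    refine (norm_mul_le _ _).trans ((mul_le_of_le_one_left (norm_nonneg _) hP).trans ?_)
    exact le_minNorm π' ρ _

/-! ### The flip -/

section Flip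

variable (H K : Type*) [NormedAddCommGroup H] [InnerProductSpace ℂ H]
  [NormedAddCommGroup K] [InnerProductSpace ℂ K]

/-- The flip `h ⊗ k ↦ k ⊗ h` of Hilbert tensor products. -/
noncomputable def HilbertTensor.flip : HilbertTensor H K →L[ℂ] HilbertTensor K H :=
  (TensorProduct.commIsometry ℂ H K).toLinearIsometry.toContinuousLinearMap.completion

variable {H K}

theorem HilbertTensor.flip_of (x : H ⊗[ℂ] K) :
    HilbertTensor.flip H K (HilbertTensor.of H K x) =
      HilbertTensor.of K H (TensorProduct.comm ℂ H K x) :=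
  ContinuousLinearMap.completion_apply_coe _ x

theorem HilbertTensor.norm_flip (x : HilbertTensor H K) : ‖HilbertTensor.flip H K x‖ = ‖x‖ := by
  induction x using HilbertTensor.induction_on with
  | hp => exact isClosed_eq (by fun_prop) (by fun_prop)
  | ih x =>
    rw [HilbertTensor.flip_of, LinearIsometry.norm_map, LinearIsometry.norm_map,
      TensorProduct.norm_comm]

theorem opTensor_flip (S : H →L[ℂ] H) (T : K →L[ℂ] K) (x : HilbertTensor H K) :
    opTensor T S (HilbertTensor.flip H K x) = HilbertTensor.flip H K (opTensor S T x) := by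
  induction x using HilbertTensor.induction_on with
  | hp => exact isClosed_eq (by fun_prop) (by fun_prop)
  | ih x =>
    rw [HilbertTensor.flip_of, opTensor_of, opTensor_of, HilbertTensor.flip_of]
    congr 1
    induction x with
    | zero => simp
    | add a b ha hb => simp only [map_add, ha, hb]
    | tmul h k => simp

end Flip

section FlipNorm

variable {A : Type u} {D : Type v} [NonUnitalCStarAlgebra A] [NonUnitalCStarAlgebra D]

theorem repTensor_flip (π : HilbertRep A) (ρ : HilbertRep D) (t : A ⊗[ℂ] D)
    (x : HilbertTensor π.space ρ.space) :
    repTensor ρ π (TensorProduct.comm ℂ A D t) (HilbertTensor.flip _ _ x) =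
      HilbertTensor.flip _ _ (repTensor π ρ t x) := by
  induction t with
  | zero => simp
  | add a b ha hb => simp only [map_add, add_apply, ha, hb]
  | tmul a d => exact opTensor_flip _ _ x

/-- The isometric flip intertwines `π ⊙ ρ` and `ρ ⊙ π`. -/
theorem minNorm_le_minNorm_comm (t : A ⊗[ℂ] D) :
    minNorm t ≤ minNorm (TensorProduct.comm ℂ A D t) := by
  refine minNorm_le fun π ρ => ContinuousLinearMap.opNorm_le_bound _ (minNorm_nonneg _) fun x => ?_
  rw [← HilbertTensor.norm_flip, ← repTensor_flip, ← HilbertTensor.norm_flip x]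
  exact (ContinuousLinearMap.le_opNorm _ _).trans (by gcongr; exact le_minNorm ρ π _)

theorem minNorm_comm (t : A ⊗[ℂ] D) : minNorm (TensorProduct.comm ℂ A D t) = minNorm t :=
  le_antisymm (by simpa using minNorm_le_minNorm_comm (TensorProduct.comm ℂ A D t))
    (minNorm_le_minNorm_comm t)

/-- The spatial norm is compatible with subalgebras in the second variable. -/
theorem minNorm_map_right {E : Type v} [NonUnitalCStarAlgebra E] (ι : D →⋆ₙₐ[ℂ] E)
    (hι : Function.Injective ι) (t : A ⊗[ℂ] D) :
    minNorm t ≤ minNorm (TensorProduct.map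
      ((NonUnitalStarAlgHom.id ℂ A : A →⋆ₙₐ[ℂ] A) : A →ₗ[ℂ] A) (ι : D →ₗ[ℂ] E) t) := by
  rw [← minNorm_comm t, ← minNorm_comm (TensorProduct.map _ _ t), ← TensorProduct.map_comm]
  exact minNorm_map_left ι hι _

end FlipNorm

/-! ### Functoriality and isometry of maps between minimal tensor products -/

namespace MinTensor

variable {A B : Type u} {D E : Type v} [NonUnitalCStarAlgebra A] [NonUnitalCStarAlgebra B]
  [NonUnitalCStarAlgebra D] [NonUnitalCStarAlgebra E]

theorem norm_map_le (f : A →⋆ₙₐ[ℂ] B) (g : D →⋆ₙₐ[ℂ] E) (x : MinTensor A D) :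
    ‖map f g x‖ ≤ ‖x‖ :=
  NonUnitalStarAlgHom.norm_apply_le (map f g) x

@[fun_prop]
theorem continuous_map (f : A →⋆ₙₐ[ℂ] B) (g : D →⋆ₙₐ[ℂ] E) : Continuous (map f g) :=
  (mapL f g).continuous

theorem map_of (f : A →⋆ₙₐ[ℂ] B) (g : D →⋆ₙₐ[ℂ] E) (t : AlgTensor A D) :
    map f g (of t) = of (AlgTensor.map f g t) :=
  mapL_of f g t

theorem norm_map_left (f : A →⋆ₙₐ[ℂ] B) (hf : Function.Injective f) (x : MinTensor A D) :
    ‖map f (NonUnitalStarAlgHom.id ℂ D) x‖ = ‖x‖ := by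
  refine le_antisymm (norm_map_le _ _ x) ?_
  induction x using induction_on with
  | hp => exact isClosed_le (by fun_prop) (by fun_prop)
  | ih t =>
    rw [map_of, of.norm_map, of.norm_map]
    exact minNorm_map_left f hf t

theorem norm_map_right (g : D →⋆ₙₐ[ℂ] E) (hg : Function.Injective g) (x : MinTensor A D) :
    ‖map (NonUnitalStarAlgHom.id ℂ A) g x‖ = ‖x‖ := by
  refine le_antisymm (norm_map_le _ _ x) ?_
  induction x using induction_on with
  | hp => exact isClosed_le (by fun_prop) (by fun_prop)
  | ih t =>
    rw [map_of, of.norm_map, of.norm_map]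
    exact minNorm_map_right g hg t

/-- A property of elements of `A ⊗_min D` that is closed, additive and true of elementary tensors
holds everywhere. -/
theorem induction_tmul {p : MinTensor A D → Prop} (x : MinTensor A D)
    (closed : IsClosed {x | p x}) (zero : p 0) (tmul : ∀ a d, p (tmul a d))
    (add : ∀ x y, p x → p y → p (x + y)) : p x := by
  induction x using induction_on with
  | hp => exact closed
  | ih t =>
    induction t using AlgTensor.induction_on with
    | zero => rw [map_zero]; exact zero
    | tmul a d => exact tmul a d
    | add x y hx hy => rw [map_add]; exact add _ _ hx hy

theorem map_map {A' : Type u} {D' : Type v} [NonUnitalCStarAlgebra A'] [NonUnitalCStarAlgebra D']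
    (f : A →⋆ₙₐ[ℂ] B) (g : D →⋆ₙₐ[ℂ] E) (f' : B →⋆ₙₐ[ℂ] A') (g' : E →⋆ₙₐ[ℂ] D')
    (x : MinTensor A D) : map f' g' (map f g x) = map (f'.comp f) (g'.comp g) x := by
  induction x using induction_tmul with
  | closed => exact isClosed_eq (by fun_prop) (by fun_prop)
  | zero => simp
  | tmul a d => simp only [map_tmul]; rfl
  | add x y hx hy => simp only [map_add, hx, hy]

theorem map_zero_left (g : D →⋆ₙₐ[ℂ] E) (x : MinTensor A D) :
    map (0 : A →⋆ₙₐ[ℂ] B) g x = 0 := by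
  induction x using induction_tmul with
  | closed => exact isClosed_eq (by fun_prop) (by fun_prop)
  | zero => simp
  | tmul a d =>
    have : (tmul (0 : B) (g d)) = of (AlgTensor.tmul 0 (g d)) := rfl
    rw [map_tmul, NonUnitalStarAlgHom.coe_zero, Pi.zero_apply, this, AlgTensor.tmul,
      TensorProduct.zero_tmul]
    exact map_zero of
  | add x y hx hy => simp only [map_add, hx, hy, add_zero]

end MinTensor

end CStarTensor

/-! ### Lifting along ⋆-homomorphisms -/

namespace NonUnitalStarAlgHom

variable {X Y : Type*} [NonUnitalCStarAlgebra X] [NonUnitalCStarAlgebra Y]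

/-- The function on the right is `s (1 - h s) ^ 2`, left expanded because `1 - h` does not vanish at
`0` and so has no meaning in the non-unital calculus. -/
theorem star_mul_self_sub_mul_cfcₙ (x : X) {h : ℝ → ℝ} (hh : Continuous h) (h0 : h 0 = 0) :
    star (x - x * cfcₙ h (star x * x)) * (x - x * cfcₙ h (star x * x)) =
      cfcₙ (fun s => s - h s * s - (s * h s - h s * s * h s)) (star x * x) := by
  have ha : IsSelfAdjoint (star x * x) := IsSelfAdjoint.star_mul_self x
  set a := star x * x with ha_def
  have hu : IsSelfAdjoint (cfcₙ h a) := cfcₙ_predicate h a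
  have e1 : cfcₙ (fun s => h s * s) a = cfcₙ h a * a := by
    rw [cfcₙ_mul h (fun s => s) a, cfcₙ_id' ℝ a]
  have e2 : cfcₙ (fun s => s * h s) a = a * cfcₙ h a := by
    rw [cfcₙ_mul (fun s => s) h a, cfcₙ_id' ℝ a]
  have e3 : cfcₙ (fun s => h s * s * h s) a = cfcₙ h a * a * cfcₙ h a := by
    rw [cfcₙ_mul (fun s => h s * s) h a, e1]
  have e4 : cfcₙ (fun s => s - h s * s) a = a - cfcₙ h a * a := by
    rw [cfcₙ_sub (fun s => s) (fun s => h s * s) a, cfcₙ_id' ℝ a, e1]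
  have e5 : cfcₙ (fun s => s * h s - h s * s * h s) a =
      a * cfcₙ h a - cfcₙ h a * a * cfcₙ h a := by
    rw [cfcₙ_sub (fun s => s * h s) (fun s => h s * s * h s) a, e2, e3]
  rw [cfcₙ_sub (fun s => s - h s * s) (fun s => s * h s - h s * s * h s) a, e4, e5,
    star_sub, star_mul, hu.star_eq, ha_def]
  noncomm_ring

/-- The norm of `p x` is the distance from `x` to the kernel of `p`. -/
theorem exists_ker_norm_sub_le (p : X →⋆ₙₐ[ℂ] Y) {x : X} {c : ℝ} (hc : 0 < c)
    (hx : ‖p x‖ ≤ c) : ∃ k, p k = 0 ∧ ‖x - k‖ ≤ c := by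
  let := CStarAlgebra.spectralOrder X
  have := CStarAlgebra.spectralOrderedRing X
  -- `h` vanishes on `[0, c ^ 2]`, which puts `x * h (x⋆x)` in the kernel; and `s (1 - h s) ^ 2 ≤ c
  -- ^ 2` for `s ≥ 0`, which bounds the remainder.
  let h : ℝ → ℝ := fun s => 1 - c / max c √s
  have hm : ∀ s, max c √s ≠ 0 := fun s => (hc.trans_le (le_max_left _ _)).ne'
  have hh : Continuous h := by
    refine continuous_const.sub (continuous_const.div ?_ hm)
    exact continuous_const.max Real.continuous_sqrt
  have hh0 : h 0 = 0 := by simp [h, hc.le, hc.ne']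
  have ha : IsSelfAdjoint (star x * x) := IsSelfAdjoint.star_mul_self x
  set a := star x * x with ha_def
  refine ⟨x * cfcₙ h a, ?_, ?_⟩
  · have hpa : ‖p a‖ ≤ c ^ 2 := by
      rw [ha_def, map_mul, map_star, CStarRing.norm_star_mul_self, sq]
      exact mul_self_le_mul_self (norm_nonneg _) hx
    have h1 : p (cfcₙ h a) = cfcₙ h (p a) :=
      NonUnitalStarAlgHomClass.map_cfcₙ (S := ℂ) p h a (hf := hh.continuousOn) (hf₀ := hh0)
        (ha := ha) (hφa := ha.map p) (hφ := AddMonoidHomClass.continuous_of_bound p 1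
          (by simpa using NonUnitalStarAlgHom.norm_apply_le p))
    rw [map_mul, h1]
    have h2 : cfcₙ h (p a) = cfcₙ (0 : ℝ → ℝ) (p a) := cfcₙ_congr fun s hs => by
      have hs' : |s| ≤ c ^ 2 :=
        (NonUnitalIsometricContinuousFunctionalCalculus.norm_quasispectrum_le (p a) hs (ha.map p)).trans hpa
      have : √s ≤ c := by
        rw [Real.sqrt_le_left hc.le]; exact (le_abs_self s).trans hs'
      simp [h, max_eq_left this, hc.ne']
    rw [h2, cfcₙ_zero, mul_zero]
  · have h3 := star_mul_self_sub_mul_cfcₙ x hh hh0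
    have h4 : ‖cfcₙ (fun s => s - h s * s - (s * h s - h s * s * h s)) a‖ ≤ c ^ 2 := by
      refine norm_cfcₙ_le fun s hs => ?_
      have hs0 : 0 ≤ s := quasispectrum_nonneg_of_nonneg a (star_mul_self_nonneg x) s hs
      have e1 : s - h s * s - (s * h s - h s * s * h s) = s * (c / max c √s) ^ 2 := by
        simp only [h]; ring
      rw [e1, Real.norm_of_nonneg (by positivity), div_pow, mul_div_assoc', div_le_iff₀
        (by have := (hc.trans_le (le_max_left c √s)); positivity), mul_comm]
      gcongr
      calc s = √s ^ 2 := (Real.sq_sqrt hs0).symm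
        _ ≤ _ := by gcongr; exact le_max_right _ _
    rw [← h3, CStarRing.norm_star_mul_self, ← sq] at h4
    exact le_of_sq_le_sq h4 hc.le

/-- Elements of the range have preimages of controlled norm, by subtracting an element of the
kernel; completeness then extends this to the closure of the range. -/
theorem surjective_of_denseRange (p : X →⋆ₙₐ[ℂ] Y) (hp : DenseRange p) :
    Function.Surjective p := by
  let f : NormedAddGroupHom X Y :=
    { toFun := p
      map_add' := map_add p
      bound' := ⟨1, fun x => by rw [one_mul]; exact NonUnitalStarAlgHom.norm_apply_le p x⟩ }
  have h : f.SurjectiveOnWith f.range 2 := by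
    rintro _ ⟨x, rfl⟩
    rcases eq_or_ne (p x) 0 with h0 | h0
    · exact ⟨0, by rw [map_zero]; exact h0.symm, by simp⟩
    · have hpos : 0 < ‖p x‖ := norm_pos_iff.mpr h0
      obtain ⟨k, hk, hxk⟩ := p.exists_ker_norm_sub_le hpos le_rfl
      refine ⟨x - k, ?_, hxk.trans ?_⟩
      · change p (x - k) = p x
        rw [map_sub, hk, sub_zero]
      · change ‖p x‖ ≤ 2 * ‖p x‖
        linarith
  intro y
  obtain ⟨x, hx, -⟩ := controlled_closure_of_complete two_pos one_pos h y (by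
    change y ∈ closure (Set.range p)
    exact hp y)
  exact ⟨x, hx⟩

end NonUnitalStarAlgHom

namespace CStarTensor

/-! ### Multiplication by `b ⊗ 1` -/

section LeftMul

variable {A B : Type u} {D E : Type v} [NonUnitalCStarAlgebra A] [NonUnitalCStarAlgebra B]
  [NonUnitalCStarAlgebra D] [NonUnitalCStarAlgebra E]

theorem repTensor_mulLeft (π : HilbertRep B) (ρ : HilbertRep D) (b : B) (t : B ⊗[ℂ] D) :
    repTensor π ρ ((LinearMap.mulLeft ℂ b).rTensor D t) =
      opTensor (π.hom b) 1 * repTensor π ρ t := by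
  induction t with
  | zero => simp
  | add x y hx hy => simp only [map_add, hx, hy, mul_add]
  | tmul a d =>
    rw [LinearMap.rTensor_tmul, repTensor_tmul, repTensor_tmul, ← opTensor_mul, one_mul,
      LinearMap.mulLeft_apply, map_mul]

/-- `D` need not have a unit, so `b ⊗ 1` is not an element of `B ⊙ D`; in each pair of
representations it is still an operator, of norm at most `‖b‖`. -/
theorem minNorm_mulLeft_le (b : B) (t : B ⊗[ℂ] D) :
    minNorm ((LinearMap.mulLeft ℂ b).rTensor D t) ≤ ‖b‖ * minNorm t := by
  refine minNorm_le fun π ρ => ?_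
  rw [repTensor_mulLeft]
  refine (norm_mul_le _ _).trans ?_
  gcongr
  · refine (opTensor_norm_le _ _).trans ?_
    refine (mul_le_of_le_one_right (norm_nonneg _) ContinuousLinearMap.norm_id_le).trans ?_
    exact NonUnitalStarAlgHom.norm_apply_le π.hom b
  · exact le_minNorm π ρ t

namespace MinTensor

theorem norm_tmul_le (b : B) (d : D) : ‖(tmul b d : MinTensor B D)‖ ≤ ‖b‖ * ‖d‖ := by
  rw [tmul, of.norm_map]
  refine minNorm_le fun π ρ => (opTensor_norm_le _ _).trans ?_
  gcongr
  · exact NonUnitalStarAlgHom.norm_apply_le π.hom b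
  · exact NonUnitalStarAlgHom.norm_apply_le ρ.hom d

/-- The elementary tensors as a bilinear map. -/
noncomputable def tmulₗ : B →ₗ[ℂ] D →ₗ[ℂ] MinTensor B D :=
  (TensorProduct.mk ℂ B D).compr₂ (of : AlgTensor B D →ₗᵢ[ℂ] MinTensor B D).toLinearMap

theorem tmulₗ_apply (b : B) (d : D) : tmulₗ b d = tmul b d := rfl

theorem continuous_tmul_right (b : B) : Continuous fun d : D => (tmul b d : MinTensor B D) :=
  (AddMonoidHomClass.continuous_of_bound (tmulₗ b : D →ₗ[ℂ] MinTensor B D) ‖b‖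
    fun d => norm_tmul_le b d)

theorem continuous_tmul_left (d : D) : Continuous fun b : B => (tmul b d : MinTensor B D) :=
  (AddMonoidHomClass.continuous_of_bound (tmulₗ.flip d : B →ₗ[ℂ] MinTensor B D) ‖d‖
    fun b => (norm_tmul_le b d).trans_eq (mul_comm _ _))

/-- Left multiplication by `b ⊗ 1`, as a bounded operator on the algebraic tensor product. -/
noncomputable def algLeftMul (b : B) : AlgTensor B D →L[ℂ] AlgTensor B D :=
  LinearMap.mkContinuous (show AlgTensor B D →ₗ[ℂ] AlgTensor B D from
    (LinearMap.mulLeft ℂ b).rTensor D) ‖b‖ fun t => minNorm_mulLeft_le b t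

/-- Left multiplication by `b ⊗ 1` on `B ⊗_min D`. -/
noncomputable def leftMul (b : B) : MinTensor B D →L[ℂ] MinTensor B D := (algLeftMul b).completion

theorem leftMul_of (b : B) (t : AlgTensor B D) : leftMul b (of t) = of (algLeftMul b t) :=
  ContinuousLinearMap.completion_apply_coe (algLeftMul b) t

theorem leftMul_tmul (b a : B) (d : D) :
    leftMul b (tmul a d : MinTensor B D) = tmul (b * a) d :=
  leftMul_of b _

theorem norm_leftMul_apply_le (b : B) (x : MinTensor B D) : ‖leftMul b x‖ ≤ ‖b‖ * ‖x‖ := by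
  induction x using induction_on with
  | hp => exact isClosed_le (by fun_prop) (by fun_prop)
  | ih t =>
    rw [leftMul_of, of.norm_map, of.norm_map]
    exact minNorm_mulLeft_le b t

theorem map_leftMul (f : A →⋆ₙₐ[ℂ] B) (g : D →⋆ₙₐ[ℂ] E) (a : A) (x : MinTensor A D) :
    map f g (leftMul a x) = leftMul (f a) (map f g x) := by
  induction x using induction_tmul with
  | closed => exact isClosed_eq (by fun_prop) (by fun_prop)
  | zero => simp
  | tmul a d => simp only [leftMul_tmul, map_tmul, map_mul]
  | add x y hx hy => simp only [map_add, hx, hy]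

-- Clear on elementary tensors, hence on algebraic ones; an `ε / 3` argument extends it, as the
-- operators are eventually contractive.
open Filter Topology in
theorem tendsto_leftMul [PartialOrder A] [StarOrderedRing A] {l : Filter A}
    (hl : l.IsIncreasingApproximateUnit) (x : MinTensor A D) :
    Tendsto (fun e => leftMul e x) l (𝓝 x) := by
  have halg : ∀ t : AlgTensor A D, Tendsto (fun e => leftMul e (of t)) l (𝓝 (of t)) := fun t => by
    induction t using AlgTensor.induction_on with
    | zero => simp only [map_zero]; exact tendsto_const_nhds
    | tmul a d =>
      have h := ((continuous_tmul_left (B := A) d).tendsto a).comp (hl.tendsto_mul_right a)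
      exact h.congr fun e => (leftMul_tmul e a d).symm
    | add s t hs ht => simp only [map_add]; exact hs.add ht
  rw [Metric.tendsto_nhds]
  intro ε hε
  obtain ⟨t, ht⟩ := isDenseInducing_of.dense.exists_dist_lt x (show 0 < ε / 3 by positivity)
  filter_upwards [hl.eventually_norm,
    (Metric.tendsto_nhds.mp (halg t)) (ε / 3) (by positivity)] with e he1 he2
  have h1 : dist (leftMul e x) (leftMul e (of t)) ≤ dist x (of t) := by
    rw [dist_eq_norm, dist_eq_norm, ← map_sub]
    exact (norm_leftMul_apply_le _ _).trans (mul_le_of_le_one_left (norm_nonneg _) he1)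
  calc dist (leftMul e x) x ≤ dist (leftMul e x) (leftMul e (of t)) +
        dist (leftMul e (of t)) (of t) + dist (of t) x := dist_triangle4 _ _ _ _
    _ < ε := by rw [dist_comm (of t) x]; linarith

end MinTensor

end LeftMul

end CStarTensor

open CStarTensor MinTensor

/-! ### Permanence properties of exactness -/

section Exactness

theorem IsShortExactCStar.map_map_eq_zero {A B C : Type v} [NonUnitalCStarAlgebra A]
    [NonUnitalCStarAlgebra B] [NonUnitalCStarAlgebra C] {i : A →⋆ₙₐ[ℂ] B} {p : B →⋆ₙₐ[ℂ] C}
    (h : IsShortExactCStar i p) {D : Type u} [NonUnitalCStarAlgebra D] (y : MinTensor A D) :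
    map p (NonUnitalStarAlgHom.id ℂ D) (map i (NonUnitalStarAlgHom.id ℂ D) y) = 0 := by
  have hpi : p.comp i = 0 := by
    ext a; exact (h.exact (i a)).mpr ⟨a, rfl⟩
  rw [map_map, hpi, map_zero_left]

/-- The range contains every elementary tensor, so it is dense, and a ⋆-homomorphism with dense
range is surjective. -/
theorem IsShortExactCStar.surjective_map {A B C : Type v} [NonUnitalCStarAlgebra A]
    [NonUnitalCStarAlgebra B] [NonUnitalCStarAlgebra C] {i : A →⋆ₙₐ[ℂ] B} {p : B →⋆ₙₐ[ℂ] C}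
    (h : IsShortExactCStar i p) (D : Type u) [NonUnitalCStarAlgebra D] :
    Function.Surjective (map p (NonUnitalStarAlgHom.id ℂ D)) := by
  refine NonUnitalStarAlgHom.surjective_of_denseRange _ fun x => ?_
  induction x using induction_tmul with
  | closed => exact isClosed_closure
  | zero => exact subset_closure ⟨0, map_zero _⟩
  | tmul c d =>
    obtain ⟨b, rfl⟩ := h.surjective c
    exact subset_closure ⟨tmul b d, map_tmul _ _ b d⟩
  | add x y hx hy =>
    refine map_mem_closure₂ continuous_add hx hy ?_
    rintro _ ⟨a, rfl⟩ _ ⟨b, rfl⟩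
    exact ⟨a + b, map_add _ a b⟩

/-- Only exactness in the middle is at stake in the definition of an exact C⋆-algebra. -/
theorem isExactCStarAlgebra_iff {D : Type u} [NonUnitalCStarAlgebra D] :
    IsExactCStarAlgebra.{u, v} D ↔
      ∀ (A B C : Type v) [NonUnitalCStarAlgebra A] [NonUnitalCStarAlgebra B]
        [NonUnitalCStarAlgebra C] (i : A →⋆ₙₐ[ℂ] B) (p : B →⋆ₙₐ[ℂ] C), IsShortExactCStar i p →
        ∀ x : MinTensor B D, map p (NonUnitalStarAlgHom.id ℂ D) x = 0 →
          x ∈ Set.range (map i (NonUnitalStarAlgHom.id ℂ D)) := by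
  refine ⟨fun h A B C _ _ _ i p hip x hx => ((h A B C i p hip).exact x).mp hx,
    fun h A B C _ _ _ i p hip => ⟨?_, fun x => ⟨h A B C i p hip x, ?_⟩, hip.surjective_map D⟩⟩
  · exact (AddMonoidHomClass.isometry_of_norm _ (norm_map_left i hip.injective)).injective
  · rintro ⟨y, rfl⟩
    exact hip.map_map_eq_zero y

theorem isClosed_range_map_left {A B : Type v} {D : Type u} [NonUnitalCStarAlgebra A]
    [NonUnitalCStarAlgebra B] [NonUnitalCStarAlgebra D] {i : A →⋆ₙₐ[ℂ] B}
    (hi : Function.Injective i) :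
    IsClosed (Set.range (map i (NonUnitalStarAlgHom.id ℂ D))) :=
  (AddMonoidHomClass.isometry_of_norm _ (norm_map_left i hi)).isClosedEmbedding.isClosed_range

/-- `(f ⊗ 1) (1 ⊗ g) = (1 ⊗ g) (f ⊗ 1)`. -/
theorem map_left_map_right {A B : Type v} {D E : Type u} [NonUnitalCStarAlgebra A]
    [NonUnitalCStarAlgebra B] [NonUnitalCStarAlgebra D] [NonUnitalCStarAlgebra E]
    (f : A →⋆ₙₐ[ℂ] B) (g : D →⋆ₙₐ[ℂ] E) (x : MinTensor A D) :
    map f (NonUnitalStarAlgHom.id ℂ E) (map (NonUnitalStarAlgHom.id ℂ A) g x) =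
      map (NonUnitalStarAlgHom.id ℂ B) g (map f (NonUnitalStarAlgHom.id ℂ D) x) := by
  rw [map_map, map_map]; rfl

theorem isExactCStarAlgebra_of_subsingleton (D : Type u) [NonUnitalCStarAlgebra D]
    [Subsingleton D] : IsExactCStarAlgebra.{u, v} D := by
  refine isExactCStarAlgebra_iff.mpr fun A B C _ _ _ i p hip x _ => ?_
  suffices h : ∀ x : MinTensor B D, x = 0 by rw [h x]; exact ⟨0, map_zero _⟩
  intro x
  induction x using induction_tmul with
  | closed => exact isClosed_eq (f := fun x : MinTensor B D => x) continuous_id continuous_const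
  | zero => rfl
  | tmul b d => rw [Subsingleton.elim d 0, ← tmulₗ_apply, map_zero]
  | add x y hx hy => rw [hx, hy, add_zero]

/-- On elementary tensors this is the fact that `i(A)`, being the kernel of `p`, is an ideal; the
range is closed. -/
theorem IsShortExactCStar.leftMul_mem_range {A B C : Type v} [NonUnitalCStarAlgebra A]
    [NonUnitalCStarAlgebra B] [NonUnitalCStarAlgebra C] {i : A →⋆ₙₐ[ℂ] B} {p : B →⋆ₙₐ[ℂ] C}
    (h : IsShortExactCStar i p) {D : Type u} [NonUnitalCStarAlgebra D] (a : A)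
    (x : MinTensor B D) :
    leftMul (i a) x ∈ Set.range (map i (NonUnitalStarAlgHom.id ℂ D)) := by
  induction x using induction_tmul with
  | closed => exact (isClosed_range_map_left h.injective).preimage (leftMul (i a)).continuous
  | zero => exact ⟨0, by simp⟩
  | tmul b d =>
    obtain ⟨c, hc⟩ := (h.exact (i a * b)).mp (by
      rw [map_mul, (h.exact (i a)).mpr ⟨a, rfl⟩, zero_mul])
    exact ⟨tmul c d, by rw [map_tmul, leftMul_tmul, hc]; rfl⟩
  | add x y hx hy =>
    obtain ⟨a, ha⟩ := hx
    obtain ⟨b, hb⟩ := hy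
    exact ⟨a + b, by rw [map_add, map_add, ha, hb]⟩

/-- C⋆-subalgebras of exact C⋆-algebras are exact. -/
theorem IsExactCStarAlgebra.of_injective {D E : Type u} [NonUnitalCStarAlgebra D]
    [NonUnitalCStarAlgebra E] (hE : IsExactCStarAlgebra.{u, v} E) (σ : D →⋆ₙₐ[ℂ] E)
    (hσ : Function.Injective σ) : IsExactCStarAlgebra.{u, v} D := by
  refine isExactCStarAlgebra_iff.mpr fun A B C _ _ _ i p hip x hx => ?_
  let := CStarAlgebra.spectralOrder A
  have := CStarAlgebra.spectralOrderedRing A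
  have hl := CStarAlgebra.increasingApproximateUnit A
  obtain ⟨y, hy⟩ := isExactCStarAlgebra_iff.mp hE A B C i p hip
    (map (NonUnitalStarAlgHom.id ℂ B) σ x) (by rw [map_left_map_right, hx, map_zero])
  refine (isClosed_range_map_left hip.injective).mem_of_tendsto (b := CStarAlgebra.approximateUnit A)
    (f := fun e => leftMul (i e) x) ?_ (Filter.Eventually.of_forall fun e => ?_)
  -- Convergence may be tested in `B ⊗ E`, where the net is the image of `(e ⊗ 1) y`, which tends to
  -- the image of `y`.
  · have hiso : Isometry (map (NonUnitalStarAlgHom.id ℂ B) σ) :=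
      AddMonoidHomClass.isometry_of_norm _ (norm_map_right (A := B) σ hσ)
    rw [hiso.isEmbedding.tendsto_nhds_iff, ← hy]
    refine (((continuous_map i (NonUnitalStarAlgHom.id ℂ E)).tendsto y).comp
      (tendsto_leftMul hl y)).congr fun e => ?_
    simp only [Function.comp_apply, map_leftMul, hy]
    rfl
  · exact hip.leftMul_mem_range e x

/-- Split extensions of exact C⋆-algebras are exact. -/
theorem IsExactCStarAlgebra.of_split {I D E : Type u} [NonUnitalCStarAlgebra I]
    [NonUnitalCStarAlgebra D] [NonUnitalCStarAlgebra E] {j : I →⋆ₙₐ[ℂ] D} {q : D →⋆ₙₐ[ℂ] E}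
    {σ : E →⋆ₙₐ[ℂ] D} (hj : Function.Injective j) (hjq : ∀ d, q d = 0 → d ∈ Set.range j)
    (hσ : ∀ e, q (σ e) = e) (hI : IsExactCStarAlgebra.{u, v} I)
    (hE : IsExactCStarAlgebra.{u, v} E) : IsExactCStarAlgebra.{u, v} D := by
  refine isExactCStarAlgebra_iff.mpr fun A B C _ _ _ i p hip x hx => ?_
  obtain ⟨y, hy⟩ := isExactCStarAlgebra_iff.mp hE A B C i p hip
    (map (NonUnitalStarAlgHom.id ℂ B) q x) (by rw [map_left_map_right, hx, map_zero])
  -- The splitting survives tensoring with `B`: `d - σ (q d)` lies in the range of `j`, and the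
  -- range of `1 ⊗ j` is closed.
  have key : ∀ x : MinTensor B D, x - map (NonUnitalStarAlgHom.id ℂ B) (σ.comp q) x ∈
      Set.range (map (NonUnitalStarAlgHom.id ℂ B) j) := fun x => by
    induction x using induction_tmul with
    | closed =>
      exact (AddMonoidHomClass.isometry_of_norm _
        (norm_map_right j hj)).isClosedEmbedding.isClosed_range.preimage
          (continuous_id.sub (continuous_map _ _))
    | zero => exact ⟨0, by simp⟩
    | tmul b d =>
      obtain ⟨k, hk⟩ := hjq (d - σ (q d)) (by rw [map_sub, hσ, sub_self])
      refine ⟨tmul b k, ?_⟩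
      rw [map_tmul, map_tmul, hk, ← tmulₗ_apply, ← tmulₗ_apply, map_sub]
      rfl
    | add x y hx hy =>
      obtain ⟨a, ha⟩ := hx
      obtain ⟨b, hb⟩ := hy
      exact ⟨a + b, by rw [map_add, map_add, ha, hb]; abel⟩
  obtain ⟨z, hz⟩ := key x
  have hsplit : map (NonUnitalStarAlgHom.id ℂ B) (σ.comp q) x =
      map i (NonUnitalStarAlgHom.id ℂ D) (map (NonUnitalStarAlgHom.id ℂ A) σ y) := by
    rw [map_left_map_right, hy, map_map]; rfl
  have hx' : x = map (NonUnitalStarAlgHom.id ℂ B) j z +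
      map i (NonUnitalStarAlgHom.id ℂ D) (map (NonUnitalStarAlgHom.id ℂ A) σ y) := by
    rw [hz, hsplit, sub_add_cancel]
  -- Both `x` and the `σ` part are killed by `p ⊗ 1`, hence so is `(1 ⊗ j) z`; and `1 ⊗ j` is
  -- isometric.
  have hz0 : map p (NonUnitalStarAlgHom.id ℂ I) z = 0 := by
    rw [← norm_eq_zero, ← norm_map_right j hj, ← map_left_map_right, norm_eq_zero]
    rw [hx', map_add, hip.map_map_eq_zero, add_zero] at hx
    exact hx
  obtain ⟨w, rfl⟩ := isExactCStarAlgebra_iff.mp hI A B C i p hip z hz0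
  exact ⟨map (NonUnitalStarAlgHom.id ℂ A) j w + map (NonUnitalStarAlgHom.id ℂ A) σ y, by
    rw [map_add, map_left_map_right, ← hx']⟩

/-- The closure of a directed union of exact C⋆-subalgebras is exact. -/
theorem IsExactCStarAlgebra.of_directed_dense {D : Type u} [NonUnitalCStarAlgebra D]
    {κ : Type*} [Nonempty κ] (S : κ → NonUnitalStarSubalgebra ℂ D)
    [∀ k, IsClosed (S k : Set D)] (hdir : Directed (· ≤ ·) S)
    (hdense : Dense (⋃ k, (S k : Set D))) (hS : ∀ k, IsExactCStarAlgebra.{u, v} (S k)) :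
    IsExactCStarAlgebra.{u, v} D := by
  refine isExactCStarAlgebra_iff.mpr fun A B C _ _ _ i p hip x hx => ?_
  let sub : ∀ k, S k →⋆ₙₐ[ℂ] D := fun k => NonUnitalStarSubalgebraClass.subtype (S k)
  let U : Set (MinTensor B D) := ⋃ k, Set.range (map (NonUnitalStarAlgHom.id ℂ B) (sub k))
  have hU : ∀ x : MinTensor B D, x ∈ closure U := fun x => by
    induction x using induction_tmul with
    | closed => exact isClosed_closure
    | zero =>
      exact subset_closure (Set.mem_iUnion.mpr ⟨Classical.arbitrary κ, 0, map_zero _⟩)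
    | tmul b d =>
      refine map_mem_closure (continuous_tmul_right b) (hdense d) fun d hd => ?_
      obtain ⟨k, hk⟩ := Set.mem_iUnion.mp hd
      exact Set.mem_iUnion.mpr ⟨k, tmul b ⟨d, hk⟩, map_tmul _ _ _ _⟩
    | add x y hx hy =>
      refine map_mem_closure₂ continuous_add hx hy fun a ha b hb => ?_
      obtain ⟨k, a, rfl⟩ := Set.mem_iUnion.mp ha
      obtain ⟨l, b, rfl⟩ := Set.mem_iUnion.mp hb
      obtain ⟨m, hkm, hlm⟩ := hdir k l
      refine Set.mem_iUnion.mpr ⟨m, map (NonUnitalStarAlgHom.id ℂ B)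
        (NonUnitalStarSubalgebra.inclusion hkm) a + map (NonUnitalStarAlgHom.id ℂ B)
        (NonUnitalStarSubalgebra.inclusion hlm) b, ?_⟩
      rw [map_add, map_map, map_map]; rfl
  refine (isClosed_range_map_left hip.injective).closure_subset_iff.mpr subset_rfl ?_
  refine Metric.mem_closure_iff.mpr fun ε hε => ?_
  obtain ⟨z, hzU, hz⟩ := Metric.mem_closure_iff.mp (hU x) (ε / 2) (half_pos hε)
  obtain ⟨k, w, rfl⟩ := Set.mem_iUnion.mp hzU
  have hsub : Function.Injective (sub k) := Subtype.val_injective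
  have hw : ‖map p (NonUnitalStarAlgHom.id ℂ (S k)) w‖ ≤ ε / 2 := by
    rw [← norm_map_right (sub k) hsub, ← map_left_map_right, ← sub_zero (map p _ _), ← hx,
      ← map_sub]
    refine (norm_map_le _ _ _).trans ?_
    rw [← dist_eq_norm, dist_comm]
    exact hz.le
  -- The approximant `w` is only nearly in the kernel over `S k`; it is moved by at most `ε / 2`
  -- into the kernel, where exactness of `S k` applies.
  obtain ⟨n, hn, hwn⟩ := NonUnitalStarAlgHom.exists_ker_norm_sub_le _ (half_pos hε) hw
  obtain ⟨m, rfl⟩ := isExactCStarAlgebra_iff.mp (hS k) A B C i p hip n hn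
  refine ⟨_, ⟨map (NonUnitalStarAlgHom.id ℂ A) (sub k) m, rfl⟩, ?_⟩
  rw [map_left_map_right]
  refine (dist_triangle _ _ _).trans_lt (add_lt_add_of_lt_of_le hz ?_ |>.trans_eq (add_halves ε))
  rw [dist_eq_norm, ← map_sub]
  exact (norm_map_le _ _ _).trans hwn

end Exactness

/-! ### Graded C⋆-algebras -/

namespace NonUnitalStarSubalgebra

variable {𝔄 : Type u} [NonUnitalCStarAlgebra 𝔄] {E I : NonUnitalStarSubalgebra ℂ 𝔄}

/-- The graph of the projection of `E + I` to the subalgebra `E` along `I`, where `I` is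
stable under multiplication by `E`. -/
def splitGraph (hl : ∀ a ∈ E, ∀ x ∈ I, a * x ∈ I) (hr : ∀ a ∈ E, ∀ x ∈ I, x * a ∈ I) :
    NonUnitalStarSubalgebra ℂ (𝔄 × 𝔄) where
  carrier := {p | p.2 ∈ E ∧ p.1 - p.2 ∈ I}
  add_mem' {p q} hp hq := ⟨add_mem hp.1 hq.1, by
    have := add_mem hp.2 hq.2
    rwa [sub_add_sub_comm] at this⟩
  zero_mem' := ⟨zero_mem E, by simp [zero_mem]⟩
  mul_mem' {p q} hp hq := ⟨mul_mem hp.1 hq.1, by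
    have h : (p * q).1 - (p * q).2 =
        (p.1 - p.2) * (q.1 - q.2) + (p.1 - p.2) * q.2 + p.2 * (q.1 - q.2) := by
      simp only [Prod.fst_mul, Prod.snd_mul]; noncomm_ring
    rw [h]
    exact add_mem (add_mem (mul_mem hp.2 hq.2) (hr _ hq.1 _ hp.2)) (hl _ hp.1 _ hq.2)⟩
  smul_mem' c p hp := ⟨SMulMemClass.smul_mem c hp.1, by
    have := SMulMemClass.smul_mem c hp.2
    rwa [smul_sub] at this⟩
  star_mem' {p} hp := ⟨star_mem hp.1, by
    have := star_mem hp.2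
    rwa [star_sub] at this⟩

variable {hl : ∀ a ∈ E, ∀ x ∈ I, a * x ∈ I} {hr : ∀ a ∈ E, ∀ x ∈ I, x * a ∈ I}

/-- Closedness of `E + I` is not evident beforehand, whereas the graph is cut out of `𝔄 × 𝔄` by
closed conditions. This is why the extension is built on the graph. -/
instance isClosed_splitGraph [hE : IsClosed (E : Set 𝔄)] [hI : IsClosed (I : Set 𝔄)] :
    IsClosed (splitGraph hl hr : Set (𝔄 × 𝔄)) :=
  (hE.preimage continuous_snd).inter (hI.preimage (continuous_fst.sub continuous_snd))

/-- The second coordinate maps the graph onto `E` with kernel `I × 0`, and the diagonal `a ↦ (a, a)`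
splits it. -/
theorem isExactCStarAlgebra_splitGraph [IsClosed (E : Set 𝔄)] [IsClosed (I : Set 𝔄)]
    (hEx : IsExactCStarAlgebra.{u, v} E) (hIx : IsExactCStarAlgebra.{u, v} I) :
    IsExactCStarAlgebra.{u, v} (splitGraph hl hr) := by
  let j : I →⋆ₙₐ[ℂ] splitGraph hl hr :=
    { toFun := fun x => ⟨(x, 0), zero_mem E, by simp⟩
      map_smul' := fun c x => by ext <;> simp
      map_zero' := rfl
      map_add' := fun x y => by ext <;> simp
      map_mul' := fun x y => by ext <;> simp
      map_star' := fun x => by ext <;> simp }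
  let q : splitGraph hl hr →⋆ₙₐ[ℂ] E :=
    { toFun := fun p => ⟨p.1.2, p.2.1⟩
      map_smul' := fun c x => rfl
      map_zero' := rfl
      map_add' := fun x y => rfl
      map_mul' := fun x y => rfl
      map_star' := fun x => rfl }
  let σ : E →⋆ₙₐ[ℂ] splitGraph hl hr :=
    { toFun := fun a => ⟨(a, a), a.2, by simp⟩
      map_smul' := fun c x => rfl
      map_zero' := rfl
      map_add' := fun x y => rfl
      map_mul' := fun x y => rfl
      map_star' := fun x => rfl }
  refine IsExactCStarAlgebra.of_split (j := j) (q := q) (σ := σ) (fun x y hxy => ?_) (fun p hp => ?_)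
    (fun _ => rfl) hIx hEx
  · exact Subtype.ext (congrArg (fun p : splitGraph hl hr => p.1.1) hxy)
  · have h2 : p.1.2 = 0 := congrArg Subtype.val hp
    refine ⟨⟨p.1.1, by simpa [h2] using p.2.2⟩, Subtype.ext (Prod.ext rfl h2.symm)⟩

/-- The sum of a closed subalgebra `E` and a closed subalgebra `I` stable under multiplication by
`E`, if direct, is closed, and it is exact if `E` and `I` are. -/
theorem exists_sum_isExactCStarAlgebra (hl : ∀ a ∈ E, ∀ x ∈ I, a * x ∈ I)
    (hr : ∀ a ∈ E, ∀ x ∈ I, x * a ∈ I) [IsClosed (E : Set 𝔄)] [IsClosed (I : Set 𝔄)]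
    (hdisj : ∀ x ∈ E, x ∈ I → x = 0)
    (hEx : IsExactCStarAlgebra.{u, v} E) (hIx : IsExactCStarAlgebra.{u, v} I) :
    ∃ S : NonUnitalStarSubalgebra ℂ 𝔄,
      S.toNonUnitalSubalgebra.toSubmodule =
        E.toNonUnitalSubalgebra.toSubmodule ⊔ I.toNonUnitalSubalgebra.toSubmodule ∧
      ∃ _ : IsClosed (S : Set 𝔄), IsExactCStarAlgebra.{u, v} S := by
  -- The first coordinate has image `E + I`. It is injective since `E ∩ I = 0`, hence isometric, and
  -- so has closed range.
  let f : splitGraph hl hr →⋆ₙₐ[ℂ] 𝔄 :=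
    { toFun := fun p => p.1.1
      map_smul' := fun c x => rfl
      map_zero' := rfl
      map_add' := fun x y => rfl
      map_mul' := fun x y => rfl
      map_star' := fun x => rfl }
  have hf : Function.Injective f := (injective_iff_map_eq_zero f).mpr fun p hp => by
    have h1 : p.1.1 = 0 := hp
    have h2 : p.1.2 = 0 := hdisj _ p.2.1 (by simpa [h1] using p.2.2)
    exact Subtype.ext (Prod.ext h1 h2)
  have hcl : IsClosed (NonUnitalStarAlgHom.range f : Set 𝔄) := by
    rw [NonUnitalStarAlgHom.coe_range]
    exact (NonUnitalStarAlgHom.isometry f hf).isClosedEmbedding.isClosed_range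
  refine ⟨NonUnitalStarAlgHom.range f, ?_, hcl, ?_⟩
  · ext x
    rw [Submodule.mem_sup]
    constructor
    · rintro ⟨p, rfl⟩
      exact ⟨p.1.2, p.2.1, p.1.1 - p.1.2, p.2.2, add_sub_cancel _ _⟩
    · rintro ⟨a, ha, y, hy, rfl⟩
      exact ⟨⟨(a + y, a), ha, by simpa using hy⟩, rfl⟩
  · let φ := StarAlgEquiv.ofInjective' f hf
    exact IsExactCStarAlgebra.of_injective (isExactCStarAlgebra_splitGraph hEx hIx)
      (φ.symm : NonUnitalStarAlgHom.range f →⋆ₙₐ[ℂ] splitGraph hl hr) φ.symm.injective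

end NonUnitalStarSubalgebra

/-! ### Sums of components over finite subsemilattices -/

namespace CStarGrading

variable {L : Type w} [SemilatticeInf L] {𝔄 : Type u} [NonUnitalCStarAlgebra 𝔄]
  (G : CStarGrading L 𝔄)

/-- A component, as a subspace. -/
abbrev componentSubmodule (i : L) : Submodule ℂ 𝔄 :=
  (G.component i).toNonUnitalSubalgebra.toSubmodule

/-- The sum of the components over a finite subsemilattice is a closed subalgebra, exact if the
components are. -/
theorem exists_finite_sum (hG : ∀ i, IsExactCStarAlgebra.{u, v} (G.component i)) (F : Finset L)
    (hF : InfClosed (F : Set L)) :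
    ∃ S : NonUnitalStarSubalgebra ℂ 𝔄,
      S.toNonUnitalSubalgebra.toSubmodule = ⨆ i ∈ F, G.componentSubmodule i ∧
      ∃ _ : IsClosed (S : Set 𝔄), IsExactCStarAlgebra.{u, v} S := by
  classical
  induction F using Finset.strongInduction with
  | H F ih =>
    rcases F.eq_empty_or_nonempty with rfl | hne
    · have h0 : ((⊥ : NonUnitalStarSubalgebra ℂ 𝔄) : Set 𝔄) = {0} := by ext; simp
      have hc : IsClosed ((⊥ : NonUnitalStarSubalgebra ℂ 𝔄) : Set 𝔄) := by
        rw [h0]; exact isClosed_singleton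
      refine ⟨⊥, ?_, hc, ?_⟩
      · exact SetLike.coe_injective (h0.trans (by simp))
      · have : Subsingleton (⊥ : NonUnitalStarSubalgebra ℂ 𝔄) := ⟨fun x y => Subtype.ext <| by
          have hx : (x : 𝔄) ∈ ((⊥ : NonUnitalStarSubalgebra ℂ 𝔄) : Set 𝔄) := x.2
          have hy : (y : 𝔄) ∈ ((⊥ : NonUnitalStarSubalgebra ℂ 𝔄) : Set 𝔄) := y.2
          rw [h0] at hx hy
          exact hx.trans hy.symm⟩
        exact isExactCStarAlgebra_of_subsingleton _
    · obtain ⟨i, hi, hmax⟩ := F.exists_maximal hne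
      -- If `k ⊓ j = i` then `i ≤ j`, and maximality of `i` forces `j = i`. So `F.erase i` is a
      -- subsemilattice absorbing `F`.
      have hmem : ∀ j ∈ F.erase i, ∀ k ∈ F, k ⊓ j ∈ F.erase i := fun j hj k hk => by
        obtain ⟨hji, hjF⟩ := Finset.mem_erase.mp hj
        refine Finset.mem_erase.mpr ⟨fun h => hji ?_, hF hk hjF⟩
        have hij : i ≤ j := h ▸ inf_le_right
        exact le_antisymm (hmax hjF hij) hij
      obtain ⟨I, hI, hIc, hIx⟩ := ih (F.erase i) (Finset.erase_ssubset hi)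
        fun k hk j hj => hmem j hj k (Finset.mem_of_mem_erase hk)
      have hI' : ∀ x, x ∈ I ↔ x ∈ ⨆ j ∈ F.erase i, G.componentSubmodule j := fun x => by
        rw [← hI]; rfl
      have hl : ∀ a ∈ G.component i, ∀ x ∈ I, a * x ∈ I := fun a ha x hx => by
        rw [hI'] at hx ⊢
        have hle : (⨆ j ∈ F.erase i, G.componentSubmodule j) ≤
            (⨆ j ∈ F.erase i, G.componentSubmodule j).comap (LinearMap.mulLeft ℂ a) :=
          iSup₂_le fun j hj y hy => Submodule.mem_iSup_of_mem _ (Submodule.mem_iSup_of_mem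
            (hmem j hj i hi) (G.mul_mem i j a ha y hy))
        exact hle hx
      have hr : ∀ a ∈ G.component i, ∀ x ∈ I, x * a ∈ I := fun a ha x hx => by
        rw [← star_mem_iff, star_mul]
        exact hl _ (star_mem ha) _ (star_mem hx)
      have hdisj : ∀ x ∈ G.component i, x ∈ I → x = 0 := fun x hx hxI => by
        refine Submodule.disjoint_def.mp (G.independent i) x hx ?_
        rw [hI'] at hxI
        exact (iSup₂_le fun j hj => le_iSup₂_of_le j (Finset.ne_of_mem_erase hj) le_rfl :
          (⨆ j ∈ F.erase i, G.componentSubmodule j) ≤ _) hxI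
      obtain ⟨S, hS, hSc, hSx⟩ :=
        NonUnitalStarSubalgebra.exists_sum_isExactCStarAlgebra hl hr hdisj (hG i) hIx
      refine ⟨S, ?_, hSc, hSx⟩
      rw [hS, hI]
      conv_rhs => rw [← Finset.insert_erase hi]
      rw [Finset.iSup_insert]

theorem isExactCStarAlgebra_of_component
    (hG : ∀ i, IsExactCStarAlgebra.{u, v} (G.component i)) : IsExactCStarAlgebra.{u, v} 𝔄 := by
  classical
  choose S hS hSc hSx using fun F : {F : Finset L // InfClosed (F : Set L)} =>
    G.exists_finite_sum hG F.1 F.2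
  have hmem : ∀ F x, x ∈ S F ↔ x ∈ ⨆ i ∈ F.1, G.componentSubmodule i := fun F x => by
    rw [← hS]; rfl
  have hmono : ∀ F F', F.1 ⊆ F'.1 → S F ≤ S F' := fun F F' h x hx => by
    rw [hmem] at hx ⊢
    exact (biSup_mono h : (⨆ i ∈ F.1, G.componentSubmodule i) ≤ _) hx
  have hdir : Directed (· ≤ ·) S := fun F F' => by
    -- A finite set has finite inf-closure, which supplies the upper bound.
    have hfin := (F.1 ∪ F'.1).finite_toSet.infClosure
    have hsub : F.1 ∪ F'.1 ⊆ hfin.toFinset := fun i hi => by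
      rw [Set.Finite.mem_toFinset]; exact subset_infClosure hi
    exact ⟨⟨hfin.toFinset, by rw [Set.Finite.coe_toFinset]; exact infClosed_infClosure⟩,
      hmono _ _ (Finset.union_subset_left hsub), hmono _ _ (Finset.union_subset_right hsub)⟩
  have : Nonempty {F : Finset L // InfClosed (F : Set L)} := ⟨⟨∅, by simp⟩⟩
  refine IsExactCStarAlgebra.of_directed_dense S hdir (G.total.mono fun x hx => ?_) hSx
  refine Set.mem_iUnion.mpr ?_
  induction hx using Submodule.span_induction with
  | mem x hx =>
    obtain ⟨i, hi⟩ := Set.mem_iUnion.mp hx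
    refine ⟨⟨{i}, by simp⟩, (hmem _ x).mpr ?_⟩
    simpa using hi
  | zero => exact ⟨Classical.arbitrary _, zero_mem _⟩
  | add x y _ _ hx hy =>
    obtain ⟨F, hx⟩ := hx
    obtain ⟨F', hy⟩ := hy
    obtain ⟨F'', h, h'⟩ := hdir F F'
    exact ⟨F'', add_mem (h hx) (h' hy)⟩
  | smul c x _ hx =>
    obtain ⟨F, hx⟩ := hx
    exact ⟨F, SMulMemClass.smul_mem c hx⟩

end CStarGrading

theorem proposition5p3p1 {L : Type w} [SemilatticeInf L] {𝔄 : Type u} [NonUnitalCStarAlgebra 𝔄]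
    (G : CStarGrading L 𝔄) :
    IsExactCStarAlgebra.{u, v} 𝔄 ↔ ∀ i : L, IsExactCStarAlgebra.{u, v} (G.component i) :=
  ⟨fun h i => h.of_injective (NonUnitalStarSubalgebraClass.subtype (G.component i))
    Subtype.val_injective, G.isExactCStarAlgebra_of_component⟩
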